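/- Let $\mathcal N$ be a finite set of players and $\mathcal M$ a finite set of items with $|\mathcal N|=|\mathcal M|=n$. Each player $i$ has a strict preference order on $\mathcal M$; $O_i(k)$ denotes its $k$-th favourite item, and the profile $\sigma$ of these orders is public. An assignment is a bijection from players to items, viewed as a 0/1 matrix, and a mechanism maps each profile to a probability distribution on assignments. For $p,q\in[0,1]^{\mathcal M}$ write $p\succeq_i q$ if $\sum_{k\le \ell}p(O_i(k))\ge\sum_{k\le \ell}q(O_i(k))$ for all $\ell\in[n]$. An assignment $P$ is stable with respect to $\sigma$ if there is no assignment $P'\ne P$ with $P'_i\succeq_i P_i$ for all players $i$; a mechanism is stable if it only produces assignments that are stable with respect to the input profile. A mechanism achieves strong equal treatment if for every profile the expected assignment matrix $P$ satisfies: whenever $O_i(k)=O_{i'}(k)$ for all $k\le\ell$, then $P(i,O_i(k))=P(i',O_{i'}(k))$ for all $k\le\ell$. Protocols run in synchronous rounds over a broadcast channel with an ideal (perfectly hiding and perfectly binding) commitment scheme; in each round a player draws fresh randomness and broadcasts a message depending on the profile, its own private history and the public transcript, and the final transcript determines an assignment. A protocol realizes a mechanism if, when all players are honest, it produces the mechanism's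 distribution for every profile. A fail-stop adversary controls a set $K$ of corrupted players: in each round it sees the transcript, the private data of the players in $K$ and the honest players' messages of that round (rushing), and it then decides, possibly at random, which players in $K$ stop broadcasting forever from this round on; otherwise all players follow the protocol. The protocol is (perfectly) maximin secure against the adversary if for every profile and every $i\notin K$ one has $\mathbb E[Q_i]\succeq_i\mathbb E[P_i]$, where $Q$ and $P$ are the random assignments produced under the adversary and under honest execution, respectively. The Preference Priority protocol is as follows. Initially all players are survivors and all items are available. For $r=1,\dots,n$, and for each available item $j$ (in an arbitrary fixed order) such that the set $C$ of survivors $i$ with $O_i(r)=j$ is nonempty, the players in $C$ play a tournament for $j$ along a binary tree whose leaves are the players in $C$; all duels whose two opponents are known are played in parallel. In a duel between players reaching a node from subtrees with $k_1$ (left) and $k_2$ (right) leaves, both commit to uniformly random elements $s_1,s_2$ of $\mathbb Z_{k_1+k_2}$ and then open them; the left player wins if $(s_1+s_2)\bmod (k_1+k_2)<k_1$, otherwise the right player wins. A player that does not open its value is identified as corrupted and loses; if both fail to open, the left player is the default winner. The winner of the tournament receives $j$, and $j$ becomes unavailable; the winner and all players identified as corrupted in the tournament cease to be survivors. (If $|C|=1$,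 the only player in $C$ wins by default.) At the end, any remaining items are given to the players without an item by a predetermined rule. Theorem. Under the ideal commitment scheme above, there exists a mechanism that is stable, achieves strong equal treatment, and is realized by the Preference Priority protocol; moreover, the Preference Priority protocol is perfectly maximin secure against every fail-stop adversary controlling at most $n-1$ players. This holds for every choice of the item orders, of the tournament trees and of the final rule. -/

import Mathlib

namespace Assignment

universe u v w

/-! ## Preferences, assignments, mechanisms -/

/-- A strict preference order on `M`, given by its favourite function: `O k` is the `k`-th
favourite item, `k = 0` being the most preferred one. -/
abbrev Preference (M : Type v) [Fintype M] := Fin (Fintype.card M) ≃ M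

/-- A preference profile. -/
abbrev Profile (N : Type u) (M : Type v) [Fintype M] := N → Preference M

/-- The 0/1 matrix of the assignment in which player `i` receives item `A i`. -/
def matrixOf {N : Type u} {M : Type v} [DecidableEq M] (A : N ≃ M) (i : N) (j : M) : ℝ :=
  if A i = j then 1 else 0

/-- The matrix induced by a distribution of assignments, i.e. the expectation of the random
assignment matrix. -/
noncomputable def expMatrix {N : Type u} {M : Type v} [Fintype N] [DecidableEq N] [Fintype M]
    [DecidableEq M] (ρ : PMF (N ≃ M)) (i : N) (j : M) : ℝ :=
  ∑ A : N ≃ M, (ρ A).toReal * matrixOf A i j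

/-- Vector dominance `p ⪰ q` with respect to the preference `O`. -/
def Dominates {M : Type v} [Fintype M] (O : Preference M) (p q : M → ℝ) : Prop :=
  ∀ j : Fin (Fintype.card M), ∑ k ∈ Finset.Iic j, q (O k) ≤ ∑ k ∈ Finset.Iic j, p (O k)

/-- Matrix dominance `P ⪰ Q` with respect to the profile `σ`. -/
def MatrixDominates {N : Type u} {M : Type v} [Fintype M] (σ : Profile N M)
    (P Q : N → M → ℝ) : Prop :=
  ∀ i, Dominates (σ i) (P i) (Q i)

/-- An assignment is stable if no different assignment dominates it. -/
def IsStable {N : Type u} {M : Type v} [Fintype M] [DecidableEq M] (σ : Profile N M)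
    (A : N ≃ M) : Prop :=
  ¬ ∃ A' : N ≃ M, A' ≠ A ∧ MatrixDominates σ (matrixOf A') (matrixOf A)

/-- Strong equal treatment of equals for a matrix. -/
def EqualTreatment {N : Type u} {M : Type v} [Fintype M] (σ : Profile N M)
    (P : N → M → ℝ) : Prop :=
  ∀ (i i' : N) (l : Fin (Fintype.card M)), (∀ k ≤ l, σ i k = σ i' k) →
    ∀ k ≤ l, P i (σ i k) = P i' (σ i' k)

/-- A mechanism maps each profile to a distribution of assignments. -/
abbrev Mechanism (N : Type u) (M : Type v) [Fintype M] := Profile N M → PMF (N ≃ M)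

/-- A mechanism is stable if it always produces a stable assignment. -/
def Mechanism.Stable {N : Type u} {M : Type v} [Fintype M] [DecidableEq M]
    (F : Mechanism N M) : Prop :=
  ∀ σ, ∀ A ∈ (F σ).support, IsStable σ A

/-- A mechanism achieves strong equal treatment if all its induced matrices do. -/
def Mechanism.StrongEqualTreatment {N : Type u} {M : Type v} [Fintype N] [DecidableEq N]
    [Fintype M] [DecidableEq M] (F : Mechanism N M) : Prop :=
  ∀ σ, EqualTreatment σ (expMatrix (F σ))

/-! ## Independent sampling -/

theorem tsum_pi_prod (ι : Type u) [Fintype ι] {α : Type w} (p : ι → PMF α) :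
    ∑' f : ι → α, ∏ i, p i (f i) = 1 := by
  classical
  revert p
  refine Fintype.induction_empty_option
    (P := fun ι _ => ∀ p : ι → PMF α, ∑' f : ι → α, ∏ i, p i (f i) = 1) ?_ ?_ ?_ ι
  · intro ι κ _ e h p
    let _ : Fintype ι := Fintype.ofEquiv κ e.symm
    rw [← h fun i => p (e i), ← (e.arrowCongr (Equiv.refl α)).tsum_eq]
    refine tsum_congr fun f => ?_
    rw [← e.prod_comp]
    simp
  · intro p
    simp
  · intro κ _ h p
    rw [← (Equiv.piOptionEquivProd (β := fun _ : Option κ => α)).symm.tsum_eq,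
      ENNReal.tsum_prod']
    simp only [Fintype.prod_option, Equiv.piOptionEquivProd_symm_apply]
    simp [ENNReal.tsum_mul_left, h fun i => p (some i), PMF.tsum_coe]

/-- The joint law of independent samples, one from each `p i`. -/
noncomputable def independent {ι : Type u} [Fintype ι] {α : Type w} (p : ι → PMF α) :
    PMF (ι → α) :=
  ⟨fun f => ∏ i, p i (f i), by
    rw [← tsum_pi_prod ι p]; exact ENNReal.summable.hasSum⟩

/-! ## Protocols over a synchronous broadcast channel with ideal commitments -/

/-- What a player does in one communication round. `reveal k` opens the player's own `k`-th most
recent commitment. -/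
inductive Action (V : Type w) where
  | idle
  | send (x : V)
  | commit (x : V)
  | reveal (k : ℕ)

/-- What the broadcast channel delivers. A commitment shows nothing about the committed value
(ideal hiding). -/
inductive Broadcast (V : Type w) where
  | idle
  | sent (x : V)
  | sealed
  | opened (k : ℕ) (x : V)

/-- The values that a player has committed to, most recent first, read off its private log of
past actions (most recent first). -/
def commitments {V : Type w} (log : List (Action V)) : List V :=
  log.filterMap fun a => match a with
    | .commit x => some x
    | _ => none

/-- The ideal commitment functionality: opening a commitment delivers exactly the value that was
committed to (perfect binding). Opening a commitment that does not exist has no effect. -/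
def publish {V : Type w} (log : List (Action V)) : Action V → Broadcast V
  | .idle => .idle
  | .send x => .sent x
  | .commit _ => .sealed
  | .reveal k => match (commitments log)[k]? with
    | some x => .opened k x
    | none => .idle

/-- The public transcript, most recent round first. `none` means that the player did not broadcast
in that round because it has stopped. -/
abbrev Transcript (N : Type u) (V : Type w) := List (N → Option (Broadcast V))

/-- A protocol with a fixed number of communication rounds. In every round a player draws its next
action from a distribution that depends on the public profile, its own private log and the public
transcript; at the end the transcript determines an assignment. -/
structure Protocol (N : Type u) (M : Type v) [Fintype M] where
  Val : Type
  rounds : ℕ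
  act : Profile N M → N → List (Action Val) → Transcript N Val → PMF (Action Val)
  outcome : Profile N M → Transcript N Val → (N ≃ M)

/-- A snapshot of an execution between two rounds. -/
structure Config (N : Type u) (V : Type w) where
  logs : N → List (Action V)
  transcript : Transcript N V

/-- The player failed to broadcast in some past round. -/
def Stopped {N : Type u} {V : Type w} (h : Transcript N V) (i : N) : Prop :=
  ∃ b ∈ h, b i = none

open Classical in
/-- The effect of one round in which the players choose the actions `a` and the players in `B` are
told to stop. A player that has stopped never broadcasts again. -/
noncomputable def Config.next {N : Type u} {V : Type w} (c : Config N V) (a : N → Action V)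
    (B : Finset N) : Config N V where
  logs i := a i :: c.logs i
  transcript :=
    (fun i => if Stopped c.transcript i ∨ i ∈ B then none else some (publish (c.logs i) (a i)))
      :: c.transcript

/-- What a rushing adversary that controls the players in `K` knows when it decides which of them
stop in the current round: the transcript, the past and current private data of the corrupted
players, and the messages that the honest players broadcast in this very round. -/
structure AdvView (N : Type u) (V : Type w) (K : Finset N) where
  transcript : Transcript N V
  corruptLogs : {i // i ∈ K} → List (Action V)
  corruptActions : {i // i ∈ K} → Action V
  honestMessages : {i // i ∉ K} → Broadcast V

/-- The strategy of a (possibly randomized) fail-stop adversary controlling the players in `K`: in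
each round it selects the corrupted players that stop broadcasting from this round on. -/
abbrev FailStopAdversary {N : Type u} {M : Type v} [Fintype M] (P : Protocol N M)
    (K : Finset N) :=
  Profile N M → AdvView N P.Val K → PMF (Finset {i // i ∈ K})

namespace Protocol

variable {N : Type u} {M : Type v} [Fintype N] [Fintype M]

/-- One round under the strategy of the adversary. -/
noncomputable def step (P : Protocol N M) {K : Finset N} (adv : FailStopAdversary P K)
    (σ : Profile N M) (c : Config N P.Val) : PMF (Config N P.Val) :=
  (independent fun i => P.act σ i (c.logs i) c.transcript).bind fun a =>
    (adv σ
      { transcript := c.transcript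
        corruptLogs := fun i => c.logs i
        corruptActions := fun i => a i
        honestMessages := fun i => publish (c.logs i) (a i) }).map fun B =>
      c.next a (B.map (Function.Embedding.subtype fun i => i ∈ K))

/-- `m` further rounds starting from the snapshot `c`. -/
noncomputable def run (P : Protocol N M) {K : Finset N} (adv : FailStopAdversary P K)
    (σ : Profile N M) : ℕ → Config N P.Val → PMF (Config N P.Val)
  | 0, c => PMF.pure c
  | m + 1, c => (P.step adv σ c).bind (run P adv σ m)

/-- The law of the assignment produced under the strategy of the adversary. -/
noncomputable def exec (P : Protocol N M) {K : Finset N} (adv : FailStopAdversary P K)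
    (σ : Profile N M) : PMF (N ≃ M) :=
  (P.run adv σ P.rounds ⟨fun _ => [], []⟩).map fun c => P.outcome σ c.transcript

/-- The law of the assignment produced when every player is honest. -/
noncomputable def honestExec (P : Protocol N M) (σ : Profile N M) : PMF (N ≃ M) :=
  P.exec (K := ∅) (fun _ _ => PMF.pure ∅) σ

/-- Under honest execution the protocol produces the distribution of the mechanism. -/
def Realizes (P : Protocol N M) (F : Mechanism N M) : Prop :=
  ∀ σ, P.honestExec σ = F σ

/-- (Perfect) maximin security against a given adversary. -/
def MaximinSecure [DecidableEq N] [DecidableEq M] (P : Protocol N M) {K : Finset N}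
    (adv : FailStopAdversary P K) : Prop :=
  ∀ σ, ∀ i ∉ K,
    Dominates (σ i) (expMatrix (P.exec adv σ) i) (expMatrix (P.honestExec σ) i)

end Protocol

/-! ## Augmented duels and tournaments -/

/-- A tournament tree. `player i w` is a position that player `i` has reached, `w` being the total
weight of the entrants below it. -/
inductive Bracket (N : Type u) where
  | player (i : N) (w : ℕ)
  | duel (l r : Bracket N)

namespace Bracket

variable {N : Type u}

/-- The players still in the tournament with their weights, from left to right. -/
def entrants : Bracket N → List (N × ℕ)
  | player i w => [(i, w)]
  | duel l r => l.entrants ++ r.entrants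

/-- The modulus `w + w'` of the duel that player `x` is to fight now, if any. All duels whose two
opponents are known are fought in parallel. -/
def modulus [DecidableEq N] : Bracket N → N → Option ℕ
  | player _ _, _ => none
  | duel (player i w) (player i' w'), x => if x = i ∨ x = i' then some (w + w') else none
  | duel l r, x => (l.modulus x).orElse fun _ => r.modulus x

/-- The winner of a duel between `i` and `i'` with weights `w` and `w'`, where `s` and `s'` are the
opened values (`none` if the player is identified as corrupted). -/
def duelWinner (i : N) (w : ℕ) (i' : N) (w' : ℕ) : Option ℕ → Option ℕ → N
  | some s, some s' => if (s + s') % (w + w') < w then i else i'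
  | some _, none => i
  | none, some _ => i'
  | none, none => i

/-- The bracket after the current duels, where `opening k x` is the value in `{0, …, k - 1}` that
player `x` has opened, if it has. -/
def advance (opening : ℕ → N → Option ℕ) : Bracket N → Bracket N
  | player i w => player i w
  | duel (player i w) (player i' w') =>
      player (duelWinner i w i' w' (opening (w + w') i) (opening (w + w') i')) (w + w')
  | duel l r => duel (l.advance opening) (r.advance opening)

/-- The winner of a finished tournament. -/
def champion : Bracket N → N
  | player i _ => i
  | duel l _ => l.champion

end Bracket

/-- The value in `{0, …, k - 1}` that player `i` opened in the round with broadcasts `b`, if any. -/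
def opening {N : Type u} (b : N → Option (Broadcast ℕ)) (k : ℕ) (i : N) : Option ℕ :=
  match b i with
  | some (.opened 0 s) => if s < k then some s else none
  | _ => none

/-- A uniformly random element of `{0, …, k - 1}`. -/
noncomputable def uniformBelow (k : ℕ) : PMF ℕ :=
  if h : 0 < k then PMF.uniformOfFinset (Finset.range k) ⟨0, Finset.mem_range.2 h⟩
  else PMF.pure 0

/-! ## The Preference Priority protocol -/

/-- The choices that the protocol leaves open: the order in which the items are treated in each
round, the shape of the tournament tree for each nonempty set of competitors (each of them enters
once, with weight 1, so that all of them win with equal probability), and the rule that hands the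
remaining items to the players without an item at the end. -/
structure Choices (N : Type u) (M : Type v) [Fintype M] where
  order : Fin (Fintype.card M) → Fin (Fintype.card M) ≃ M
  bracket : (C : Finset N) → C.Nonempty → Bracket N
  bracket_entrants : ∀ C hC,
    ((bracket C hC).entrants : Multiset (N × ℕ)) = C.val.map fun i => (i, 1)
  complete : (N → Option M) → (N ≃ M)
  complete_extends : ∀ A : N → Option M,
    (∀ i i' j, A i = some j → A i' = some j → i = i') →
      ∀ i j, A i = some j → complete A i = j

/-- A tournament in progress: the item at stake, the set of competitors, the current bracket and
the players identified as corrupted so far. -/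
structure Tournament (N : Type u) (M : Type v) where
  item : M
  group : Finset N
  bracket : Bracket N
  corrupted : Finset N

/-- The public state of the protocol: survivors, available items, partial assignment, and the
tournament in progress. -/
structure PPState (N : Type u) (M : Type v) where
  survivors : Finset N
  available : Finset M
  assigned : N → Option M
  current : Option (Tournament N M)

/-- The tasks of the single communication rounds. -/
inductive Task (M : Type v) [Fintype M] where
  | start (r : Fin (Fintype.card M)) (j : M)
  | commit
  | reveal
  | finish

namespace Choices

variable {N : Type u} {M : Type v} [Fintype N] [DecidableEq N] [Fintype M] [DecidableEq M]

/-- The timetable: for `r = 0, …, n - 1` and for each item `j`, the tournament for `j` among the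
survivors whose `r`-th favourite item is `j`, with time for `n` levels of duels (which is enough
for every tree with at most `n` entrants). -/
def schedule (c : Choices N M) : List (Task M) :=
  (List.finRange (Fintype.card M)).flatMap fun r =>
    (List.finRange (Fintype.card M)).flatMap fun k =>
      Task.start r (c.order r k) ::
        (List.replicate (Fintype.card M) [Task.commit, Task.reveal]).flatten ++ [Task.finish]

/-- The state after a communication round with the given task and broadcasts. -/
def nextState (c : Choices N M) (σ : Profile N M) (b : N → Option (Broadcast ℕ))
    (s : PPState N M) : Task M → PPState N M
  | .start r j =>
      let C := s.survivors.filter fun i => σ i r = j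
      if h : j ∈ s.available ∧ C.Nonempty then
        { s with current := some ⟨j, C, c.bracket C h.2, ∅⟩ }
      else { s with current := none }
  | .commit => s
  | .reveal => match s.current with
      | none => s
      | some t =>
          { s with
            current := some
              { t with
                bracket := t.bracket.advance (opening b)
                corrupted := t.corrupted ∪ t.group.filter fun i =>
                  ∃ k ∈ t.bracket.modulus i, opening b k i = none } }
  | .finish => match s.current with
      | none => s
      | some t =>
          let winner := t.bracket.champion
          let losers := t.group \ (insert winner t.corrupted)
          { survivors := s.survivors \ (t.group \ losers)
            available := s.available.erase t.item
            assigned := Function.update s.assigned winner (some t.item)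
            current := none }

/-- The state determined by a transcript. -/
def state (c : Choices N M) (σ : Profile N M) : Transcript N ℕ → PPState N M
  | [] => ⟨Finset.univ, Finset.univ, fun _ => none, none⟩
  | b :: h => match c.schedule[h.length]? with
      | some task => c.nextState σ b (c.state σ h) task
      | none => c.state σ h

/-- The action of player `i` for a given task: the current duellists commit to a uniformly random
residue and open it in the next round; everybody else is idle. -/
noncomputable def action (s : PPState N M) (i : N) : Task M → PMF (Action ℕ)
  | .commit => match s.current.bind fun t => t.bracket.modulus i with
      | some k => (uniformBelow k).map Action.commit
      | none => PMF.pure Action.idle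
  | .reveal => match s.current.bind fun t => t.bracket.modulus i with
      | some _ => PMF.pure (Action.reveal 0)
      | none => PMF.pure Action.idle
  | _ => PMF.pure Action.idle

/-- The Preference Priority protocol. -/
noncomputable def preferencePriority (c : Choices N M) : Protocol N M where
  Val := ℕ
  rounds := c.schedule.length
  act σ i _ h := match c.schedule[h.length]? with
    | some task => action (c.state σ h) i task
    | none => PMF.pure Action.idle
  outcome σ h := c.complete (c.state σ h).assigned

end Choices

end Assignment

/-! The protocol is compared with an ideal process (`ideal`) in which every contested item goes to a
uniformly random competitor and nobody is expelled.

The central inequality is `mean_ideal_le_mean_run`: against any fail-stop adversary controlling `K`,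
the expectation of `φ` in the execution is at least its ideal expectation. The condition on `φ` is
that giving an item to `a'` and expelling `X'` is at least as good as giving it to `a` and expelling
`X`, whenever `X ⊆ X' ⊆ K` and `a` is `a'` or lies in `X'`. Within a tournament the potential is the
sum over the remaining entrants of weight times value of winning (`Bracket.score`). Since one
uniform share makes the sum of two shares uniform, a level of honest duels preserves its expectation
(`Bracket.mean_score_advance`). The shares are fixed before anything is opened, and withholding an
opening can change the winner of a duel only if the former winner withheld, in which case that
player is expelled. Hence, for each fixed draw of shares, no abort lowers the potential
(`Bracket.score_advance_mono`). The last entrant carries the total weight, and division by it gives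
the uniform average of the ideal process.

The inequality is used twice. For `K = ∅` every `φ` is admissible, and a one-sided inequality for
all `φ` forces equality of laws; so the honest protocol is the ideal process. Stability then follows
by induction along the process (`ideal_agree`), and equal treatment from its symmetry under
exchanging players with the same top choices (`ideal_relabel`).

For an honest player `i` and a rank `l`, both processes are cut after round `l`, and `φ` indicates
that `i` has left the competition. It is admissible because fewer rivals and more items never hurt
(`mean_ideal_mono`). An honest player leaves only with an item, so the means of `φ` control the
probabilities of a rank at most `l`, which are the partial sums in the dominance relation. -/

namespace Assignment

open scoped ENNReal

universe u v w

set_option linter.unusedSectionVars false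

/-! ## Expectations of `ℝ≥0∞`-valued functions -/

/-- The expectation of `f` under the law `p`. -/
noncomputable def mean {α : Type u} (p : PMF α) (f : α → ℝ≥0∞) : ℝ≥0∞ := ∑' a, p a * f a

section Mean

variable {α : Type u} {β : Type v}

theorem mean_pure (a : α) (f : α → ℝ≥0∞) : mean (PMF.pure a) f = f a := by
  classical
  unfold mean
  rw [tsum_eq_single a]
  · simp
  · intro b hb; simp [PMF.pure_apply, hb]

theorem mean_bind (p : PMF α) (g : α → PMF β) (f : β → ℝ≥0∞) :
    mean (p.bind g) f = mean p fun a => mean (g a) f := by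
  simp only [mean, PMF.bind_apply, ← ENNReal.tsum_mul_right, ← ENNReal.tsum_mul_left]
  rw [ENNReal.tsum_comm]
  simp only [mul_assoc]

theorem mean_map (p : PMF α) (g : α → β) (f : β → ℝ≥0∞) :
    mean (p.map g) f = mean p (f ∘ g) := by
  rw [← PMF.bind_pure_comp, mean_bind]
  congr 1; funext a; simp [mean_pure]

theorem mean_mono (p : PMF α) {f g : α → ℝ≥0∞} (h : ∀ a ∈ p.support, f a ≤ g a) :
    mean p f ≤ mean p g := by
  refine ENNReal.tsum_le_tsum fun a => ?_
  by_cases ha : p a = 0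
  · simp [ha]
  · gcongr; exact h a ((p.mem_support_iff a).2 ha)

theorem mean_congr (p : PMF α) {f g : α → ℝ≥0∞} (h : ∀ a ∈ p.support, f a = g a) :
    mean p f = mean p g :=
  le_antisymm (mean_mono p fun a ha => (h a ha).le) (mean_mono p fun a ha => (h a ha).ge)

theorem mean_const (p : PMF α) (x : ℝ≥0∞) : mean p (fun _ => x) = x := by
  simp [mean, ENNReal.tsum_mul_right, p.tsum_coe]

theorem mean_add (p : PMF α) (f g : α → ℝ≥0∞) :
    mean p (fun a => f a + g a) = mean p f + mean p g := by
  simp [mean, mul_add, ENNReal.tsum_add]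

theorem mean_const_mul (p : PMF α) (x : ℝ≥0∞) (f : α → ℝ≥0∞) :
    mean p (fun a => x * f a) = x * mean p f := by
  simp only [mean, ← ENNReal.tsum_mul_left]
  congr 1; funext a; ring

theorem le_mean (p : PMF α) {f : α → ℝ≥0∞} {x : ℝ≥0∞} (h : ∀ a ∈ p.support, x ≤ f a) :
    x ≤ mean p f := by
  rw [← mean_const p x]; exact mean_mono p h

theorem mean_uniformOfFinset (s : Finset α) (hs : s.Nonempty) (f : α → ℝ≥0∞) :
    mean (PMF.uniformOfFinset s hs) f = (∑ a ∈ s, f a) / s.card := by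
  classical
  unfold mean
  rw [tsum_eq_sum (s := s)]
  · simp only [PMF.uniformOfFinset_apply]
    rw [Finset.sum_congr rfl (g := fun a => f a * (s.card : ℝ≥0∞)⁻¹)]
    · rw [← Finset.sum_mul, div_eq_mul_inv]
    · intro a ha; simp [ha, mul_comm]
  · intro a ha; simp [PMF.uniformOfFinset_apply, ha]

theorem card_mul_mean_uniformOfFinset (s : Finset α) (hs : s.Nonempty) (f : α → ℝ≥0∞) :
    s.card * mean (PMF.uniformOfFinset s hs) f = ∑ a ∈ s, f a := by
  rw [mean_uniformOfFinset, ENNReal.mul_div_cancel]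
  · simpa using hs.ne_empty
  · simp

/-- A law that dominates another one pointwise in expectation is equal to it. -/
theorem eq_of_mean_le {p q : PMF α} (h : ∀ f, mean p f ≤ mean q f) : p = q := by
  classical
  have key : ∀ a, p a ≤ q a := fun a => by
    have := h (fun b => if b = a then 1 else 0)
    unfold mean at this
    rw [tsum_eq_single a (by intro b hb; simp [hb]), tsum_eq_single a (by intro b hb; simp [hb])]
      at this
    simpa using this
  ext a
  -- Both laws have total mass 1, so a strict inequality at one point is impossible.
  refine le_antisymm (key a) ?_
  by_contra hlt
  push Not at hlt
  have := ENNReal.tsum_lt_tsum (f := p) (g := q) (by simp [p.tsum_coe]) key hlt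
  rw [p.tsum_coe, q.tsum_coe] at this
  exact lt_irrefl _ this

theorem mean_ne_top (p : PMF α) {f : α → ℝ≥0∞} (h : ∀ a, f a ≤ 1) : mean p f ≠ ∞ :=
  ne_top_of_le_ne_top ENNReal.one_ne_top
    ((mean_mono p fun a _ => h a).trans (mean_const p 1).le)

end Mean

/-! ## Independent samples -/

section Independent

variable {ι : Type u} [Fintype ι] {α : Type w}

theorem mem_support_independent {p : ι → PMF α} {f : ι → α}
    (h : f ∈ (independent p).support) (i : ι) : f i ∈ (p i).support := by
  rw [PMF.mem_support_iff] at h ⊢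
  intro h0
  exact h (Finset.prod_eq_zero (Finset.mem_univ i) h0)

/-- Resampling one coordinate does not change the joint law. -/
theorem mean_independent_update [DecidableEq ι] (p : ι → PMF α) (i : ι) (F : (ι → α) → ℝ≥0∞) :
    mean (independent p) F =
      mean (independent p) fun f => mean (p i) fun x => F (Function.update f i x) := by
  have happ : ∀ f, independent p f = ∏ i, p i (f i) := fun _ => rfl
  simp only [mean, happ]
  rw [← (Equiv.funSplitAt i α).symm.tsum_eq, ← (Equiv.funSplitAt i α).symm.tsum_eq,
    ENNReal.tsum_prod', ENNReal.tsum_prod']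
  have hprod : ∀ (x : α) (g : {j // j ≠ i} → α),
      ∏ j, p j ((Equiv.funSplitAt i α).symm (x, g) j) = p i x * ∏ j : {j // j ≠ i}, p j (g j) := by
    intro x g
    rw [Fintype.prod_eq_mul_prod_subtype_ne _ i]
    congr 1
    · simp
    · refine Finset.prod_congr rfl fun j _ => ?_
      simp [j.2]
  have hupd : ∀ (x y : α) (g : {j // j ≠ i} → α),
      Function.update ((Equiv.funSplitAt i α).symm (x, g)) i y
        = (Equiv.funSplitAt i α).symm (y, g) := by
    intro x y g
    funext j
    by_cases hj : j = i
    · subst hj; simp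
    · simp [hj]
  simp only [hprod, hupd]
  have hfac : ∀ x : α, ∑' g : {j // j ≠ i} → α, p i x * (∏ j : {j // j ≠ i}, p j (g j)) *
      (∑' y, p i y * F ((Equiv.funSplitAt i α).symm (y, g)))
      = p i x * ∑' g : {j // j ≠ i} → α, (∏ j : {j // j ≠ i}, p j (g j)) *
      (∑' y, p i y * F ((Equiv.funSplitAt i α).symm (y, g))) := by
    intro x
    rw [← ENNReal.tsum_mul_left]
    simp only [mul_assoc]
  simp only [hfac]
  rw [ENNReal.tsum_mul_right, (p i).tsum_coe, one_mul, ENNReal.tsum_comm]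
  refine tsum_congr fun g => ?_
  rw [← ENNReal.tsum_mul_left]
  refine tsum_congr fun y => ?_
  ring

end Independent

/-! ## Uniform residues -/

/-- Translation by `s` permutes the residues modulo `k`. This is why a single uniform share hides
the influence of the other one on a duel. -/
theorem sum_range_add_mod {β : Type u} [AddCommMonoid β] (g : ℕ → β) (s k : ℕ) (hk : 0 < k) :
    ∑ x ∈ Finset.range k, g ((s + x) % k) = ∑ x ∈ Finset.range k, g x := by
  have hinj : Set.InjOn (fun x => (s + x) % k) (Finset.range k : Set ℕ) := by
    intro x hx y hy hxy
    simp only [Finset.coe_range, Set.mem_Iio] at hx hy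
    have : x ≡ y [MOD k] := Nat.ModEq.add_left_cancel' s hxy
    exact this.eq_of_lt_of_lt hx hy
  have himg : (Finset.range k).image (fun x => (s + x) % k) = Finset.range k := by
    refine Finset.eq_of_subset_of_card_le ?_ ?_
    · intro y hy
      obtain ⟨x, -, rfl⟩ := Finset.mem_image.1 hy
      exact Finset.mem_range.2 (Nat.mod_lt _ hk)
    · rw [Finset.card_image_of_injOn hinj]
  conv_rhs => rw [← himg, Finset.sum_image hinj]

theorem mul_mean_uniformBelow (k : ℕ) (hk : 0 < k) (f : ℕ → ℝ≥0∞) :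
    k * mean (uniformBelow k) f = ∑ x ∈ Finset.range k, f x := by
  have := card_mul_mean_uniformOfFinset (Finset.range k) ⟨0, Finset.mem_range.2 hk⟩ f
  rw [uniformBelow, dif_pos hk]
  simpa using this

theorem lt_of_mem_support_uniformBelow {k x : ℕ} (hk : 0 < k)
    (hx : x ∈ (uniformBelow k).support) : x < k := by
  rw [uniformBelow, dif_pos hk] at hx
  exact Finset.mem_range.1
    ((PMF.mem_support_uniformOfFinset_iff (s := Finset.range k) ⟨0, Finset.mem_range.2 hk⟩ x).1 hx)

/-- A duel with one uniformly random share is won by each side with probability proportional to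
its weight. -/
theorem mul_mean_uniformBelow_duel (w w' s : ℕ) (hk : 0 < w + w') (x y : ℝ≥0∞) :
    ((w + w' : ℕ) : ℝ≥0∞) *
        mean (uniformBelow (w + w')) (fun s' => if (s + s') % (w + w') < w then x else y)
      = w * x + w' * y := by
  rw [mul_mean_uniformBelow _ hk,
    sum_range_add_mod (fun z => if z < w then x else y) s (w + w') hk, Finset.sum_range_add]
  congr 1
  · rw [Finset.sum_congr rfl (g := fun _ => x)]
    · simp
    · intro a ha; simp [Finset.mem_range.1 ha]
  · simp

/-! ## The ideal process: every contested item goes to a uniformly random competitor -/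

section Ideal

variable {N : Type u} {M : Type v} [DecidableEq N] [DecidableEq M]

/-- The state after `w` has received `j` and the players in `X` have been expelled. -/
def PPState.award (s : PPState N M) (w : N) (j : M) (X : Finset N) : PPState N M where
  survivors := s.survivors \ insert w X
  available := s.available.erase j
  assigned := Function.update s.assigned w (some j)
  current := none

variable [Fintype M]

/-- The survivors that compete for `j` in round `r`. -/
def PPState.competitors (s : PPState N M) (σ : Profile N M) (r : Fin (Fintype.card M)) (j : M) :
    Finset N :=
  s.survivors.filter fun i => σ i r = j

theorem PPState.mem_competitors {s : PPState N M} {σ : Profile N M} {r : Fin (Fintype.card M)}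
    {j : M} {i : N} : i ∈ s.competitors σ r j ↔ i ∈ s.survivors ∧ σ i r = j := by
  simp [PPState.competitors]

/-- One ideal tournament. -/
noncomputable def idealStep (σ : Profile N M) (e : Fin (Fintype.card M) × M) (s : PPState N M) :
    PMF (PPState N M) :=
  if h : e.2 ∈ s.available ∧ (s.competitors σ e.1 e.2).Nonempty then
    (PMF.uniformOfFinset _ h.2).map fun w => s.award w e.2 ∅
  else PMF.pure s

/-- A sequence of ideal tournaments. -/
noncomputable def ideal (σ : Profile N M) :
    List (Fin (Fintype.card M) × M) → PPState N M → PMF (PPState N M)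
  | [], s => PMF.pure s
  | e :: L, s => (idealStep σ e s).bind (ideal σ L)

variable {σ : Profile N M}

theorem mem_support_idealStep {e : Fin (Fintype.card M) × M} {s s' : PPState N M}
    (h : s' ∈ (idealStep σ e s).support) :
    (e.2 ∈ s.available ∧ ∃ w ∈ s.competitors σ e.1 e.2, s' = s.award w e.2 ∅) ∨
      (¬ (e.2 ∈ s.available ∧ (s.competitors σ e.1 e.2).Nonempty) ∧ s' = s) := by
  unfold idealStep at h
  split_ifs at h with hc
  · rw [PMF.support_map] at h
    obtain ⟨w, hw, rfl⟩ := h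
    exact Or.inl ⟨hc.1, w, (PMF.mem_support_uniformOfFinset_iff _ _).1 hw, rfl⟩
  · rw [PMF.support_pure] at h
    exact Or.inr ⟨hc, h⟩

theorem ideal_append (L L' : List (Fin (Fintype.card M) × M)) (s : PPState N M) :
    ideal σ (L ++ L') s = (ideal σ L s).bind (ideal σ L') := by
  induction L generalizing s with
  | nil => simp [ideal]
  | cons e L ih =>
    rw [List.cons_append, ideal, ideal, PMF.bind_bind]
    congr 1
    funext t
    exact ih t

/-- Invariants of the ideal process. -/
theorem ideal_induction (I : List (Fin (Fintype.card M) × M) → PPState N M → Prop)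
    (award : ∀ r j L s w, I ((r, j) :: L) s → j ∈ s.available → w ∈ s.survivors → σ w r = j →
      I L (s.award w j ∅))
    (skip : ∀ r j L s, I ((r, j) :: L) s →
      (j ∈ s.available → ∀ w ∈ s.survivors, σ w r ≠ j) → I L s)
    {L : List (Fin (Fintype.card M) × M)} {s s' : PPState N M} (h : I L s)
    (hs' : s' ∈ (ideal σ L s).support) : I [] s' := by
  induction L generalizing s with
  | nil =>
    simp only [ideal, PMF.support_pure, Set.mem_singleton_iff] at hs'
    rwa [hs']
  | cons e L ih =>
    obtain ⟨r, j⟩ := e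
    rw [ideal, PMF.mem_support_bind_iff] at hs'
    obtain ⟨t, ht, hs'⟩ := hs'
    refine ih ?_ hs'
    rcases mem_support_idealStep ht with ⟨hj, w, hw, rfl⟩ | ⟨hn, rfl⟩
    · obtain ⟨hw, hwj⟩ := PPState.mem_competitors.1 hw
      exact award r j L s w h hj hw hwj
    · refine skip r j L t h fun hj w hw hwj => hn ⟨hj, w, ?_⟩
      exact PPState.mem_competitors.2 ⟨hw, hwj⟩

/-- The bookkeeping of a process in which nobody is expelled. -/
structure Consistent (s : PPState N M) : Prop where
  mem_survivors : ∀ x, x ∈ s.survivors ↔ s.assigned x = none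
  mem_available : ∀ j, j ∈ s.available ↔ ∀ x, s.assigned x ≠ some j
  injective : ∀ x y j, s.assigned x = some j → s.assigned y = some j → x = y

theorem Consistent.award {s : PPState N M} (h : Consistent s) {w : N} {j : M}
    (hj : j ∈ s.available) (hw : w ∈ s.survivors) : Consistent (s.award w j ∅) where
  mem_survivors x := by
    by_cases hx : x = w
    · subst hx; simp [PPState.award]
    · simp [PPState.award, hx, h.mem_survivors]
  mem_available k := by
    have hwn := (h.mem_survivors w).1 hw
    simp only [PPState.award, Finset.mem_erase, h.mem_available]
    constructor
    · rintro ⟨hk, hx⟩ x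
      by_cases hxw : x = w
      · subst hxw; simpa using fun h => hk h.symm
      · simpa [hxw] using hx x
    · intro hx
      have hk : k ≠ j := by
        rintro rfl
        simpa using hx w
      refine ⟨hk, fun x => ?_⟩
      by_cases hxw : x = w
      · subst hxw; simp [hwn]
      · simpa [hxw] using hx x
  injective x y k hx hy := by
    have hjn := (h.mem_available j).1 hj
    simp only [PPState.award] at hx hy
    by_cases hxw : x = w <;> by_cases hyw : y = w
    · rw [hxw, hyw]
    · subst hxw
      simp only [Function.update_self, Option.some.injEq] at hx
      subst hx
      exact absurd (by simpa [hyw] using hy) (hjn y)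
    · subst hyw
      simp only [Function.update_self, Option.some.injEq] at hy
      subst hy
      exact absurd (by simpa [hxw] using hx) (hjn x)
    · exact h.injective x y k (by simpa [hxw] using hx) (by simpa [hyw] using hy)

/-- A survivor has an available item only where the process still has to come to it. -/
def Pending (σ : Profile N M) (L : List (Fin (Fintype.card M) × M)) (s : PPState N M) : Prop :=
  ∀ x ∈ s.survivors, ∀ r, σ x r ∈ s.available → (r, σ x r) ∈ L

/-- Only the entry at the head is lost, and its item is no longer available. -/
theorem Pending.award {r : Fin (Fintype.card M)} {j : M} {L : List (Fin (Fintype.card M) × M)}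
    {s : PPState N M} (h : Pending σ ((r, j) :: L) s) (w : N) :
    Pending σ L (s.award w j ∅) := by
  intro x hx r' hr'
  simp only [PPState.award, Finset.mem_sdiff, Finset.mem_erase] at hx hr'
  rcases List.mem_cons.1 (h x hx.1 r' hr'.2) with he | he
  · exact absurd (congrArg Prod.snd he) hr'.1
  · exact he

theorem Pending.skip {r : Fin (Fintype.card M)} {j : M} {L : List (Fin (Fintype.card M) × M)}
    {s : PPState N M} (h : Pending σ ((r, j) :: L) s)
    (hn : j ∈ s.available → ∀ w ∈ s.survivors, σ w r ≠ j) : Pending σ L s := by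
  intro x hx r' hr'
  rcases List.mem_cons.1 (h x hx r' hr') with he | he
  · obtain ⟨rfl, rfl⟩ := Prod.mk.inj he
    exact absurd rfl (hn hr' x hx)
  · exact he

theorem ideal_consistent_pending {L : List (Fin (Fintype.card M) × M)} {s s' : PPState N M}
    (hc : Consistent s) (hp : Pending σ L s) (hs' : s' ∈ (ideal σ L s).support) :
    Consistent s' ∧ Pending σ [] s' :=
  ideal_induction (σ := σ) (fun L s => Consistent s ∧ Pending σ L s)
    (fun _ _ _ _ w h hj hw _ => ⟨h.1.award hj hw, h.2.award w⟩)
    (fun _ _ _ _ h hn => ⟨h.1, h.2.skip hn⟩) ⟨hc, hp⟩ hs'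

theorem ideal_consistent {L : List (Fin (Fintype.card M) × M)} {s s' : PPState N M}
    (hc : Consistent s) (hs' : s' ∈ (ideal σ L s).support) : Consistent s' :=
  ideal_induction (σ := σ) (fun _ s => Consistent s) (fun _ _ _ _ _ h hj hw _ => h.award hj hw)
    (fun _ _ _ _ h _ => h) hc hs'

/-- A finished process has assigned an item to everybody. -/
theorem assigned_ne_none [Fintype N] (hcard : Fintype.card N = Fintype.card M)
    {s : PPState N M} (hc : Consistent s) (hp : Pending σ [] s) (x : N) :
    s.assigned x ≠ none := by
  intro hx
  have hx' := (hc.mem_survivors x).2 hx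
  -- A survivor `x` left over at the end would mean that no item is available. The owners of the
  -- items then form an injection between sets of equal size, hence a bijection, so `x` owns an item
  -- after all.
  have hall : ∀ j : M, ∃ y, s.assigned y = some j := by
    intro j
    by_contra hj
    push Not at hj
    have := hp x hx' ((σ x).symm j) (by simpa using (hc.mem_available j).2 hj)
    simp at this
  choose f hf using hall
  have hinj : Function.Injective f := fun j k h => by
    have h1 := hf j
    rw [h, hf k] at h1
    exact (Option.some.inj h1).symm
  have hbij := (Fintype.bijective_iff_injective_and_card f).2 ⟨hinj, hcard.symm⟩
  obtain ⟨j, hj⟩ := hbij.2 x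
  have := hf j
  rw [hj, hx] at this
  exact Option.some_ne_none _ this.symm

/-- Along the ideal process, an assignment that gives nobody a worse item than the one already
received agrees with what has been assigned. -/
theorem ideal_agree (A : N ≃ M) {L : List (Fin (Fintype.card M) × M)}
    (hL : L.Pairwise fun a b => a.1 ≤ b.1) {s s' : PPState N M} (hc : Consistent s)
    (hp : Pending σ L s) (hs : ∀ x, s.assigned x = none)
    (hs' : s' ∈ (ideal σ L s).support)
    (hA : ∀ x j, s'.assigned x = some j → (σ x).symm (A x) ≤ (σ x).symm j) :
    ∀ x j, s'.assigned x = some j → A x = j := by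
  have key := ideal_induction (σ := σ) (fun L s => L.Pairwise (fun a b => a.1 ≤ b.1) ∧
      Consistent s ∧ Pending σ L s ∧
      ((∀ x j, s.assigned x = some j → (σ x).symm (A x) ≤ (σ x).symm j) →
        ∀ x j, s.assigned x = some j → A x = j)) ?_ ?_
      ⟨hL, hc, hp, fun _ x j hx => by simp [hs x] at hx⟩ hs'
  · exact key.2.2.2 hA
  · rintro r j L s w ⟨hL, hc, hp, ih⟩ hj hw hwj
    refine ⟨hL.of_cons, hc.award hj hw, hp.award w, fun hA x k hx => ?_⟩
    have hwn := (hc.mem_survivors w).1 hw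
    have hold : ∀ y m, s.assigned y = some m → A y = m := ih fun y m hy => by
      have hyw : y ≠ w := by rintro rfl; simp [hwn] at hy
      exact hA y m (by simpa [PPState.award, hyw] using hy)
    by_cases hxw : x = w
    · subst hxw
      have hle := hA x j (by simp [PPState.award])
      have hkj : k = j := by simpa [PPState.award, eq_comm] using hx
      subst hkj
      subst hwj
      by_contra hne
      have hlt : (σ x).symm (A x) < r := by
        refine lt_of_le_of_ne (by simpa using hle) fun he => hne ?_
        rw [← he]; simp
      -- A strictly better item would have its entry in an earlier round, but only rounds from `r`
      -- on are pending. So it already has an owner `y`, on whom `A` agrees by induction, and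
      -- injectivity of `A` gives `y = x`.
      have hun : A x ∉ s.available := fun hav => by
        have hmem := hp x hw ((σ x).symm (A x)) (by simpa using hav)
        rcases List.mem_cons.1 hmem with he | he
        · exact hlt.ne (congrArg Prod.fst he)
        · exact absurd (List.rel_of_pairwise_cons hL he) (not_le.2 hlt)
      rw [hc.mem_available] at hun
      push Not at hun
      obtain ⟨y, hy⟩ := hun
      have := A.injective (hold y _ hy)
      subst this
      simp [hwn] at hy
    · exact hold x k (by simpa [PPState.award, hxw] using hx)
  · rintro r j L s ⟨hL, hc, hp, ih⟩ hn
    exact ⟨hL.of_cons, hc, hp.skip hn, ih⟩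

theorem ideal_assigned_mono {L : List (Fin (Fintype.card M) × M)} {s s' : PPState N M}
    (hc : Consistent s) (hs' : s' ∈ (ideal σ L s).support) {x : N} {j : M}
    (hx : s.assigned x = some j) : s'.assigned x = some j := by
  refine (ideal_induction (σ := σ) (fun _ t => Consistent t ∧ t.assigned x = some j) ?_ ?_
    ⟨hc, hx⟩ hs').2
  · rintro r k L s w ⟨hc, hx⟩ hk hw -
    refine ⟨hc.award hk hw, ?_⟩
    have hxw : x ≠ w := by
      rintro rfl
      simp [(hc.mem_survivors x).1 hw] at hx
    simpa [PPState.award, hxw] using hx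
  · exact fun _ _ _ _ h _ => h

/-- Together with `ideal_assigned_mono` this shows that later rounds do not affect who holds an item
of rank at most `l`. -/
theorem ideal_assigned_cases {L : List (Fin (Fintype.card M) × M)} {s s' : PPState N M}
    (hs' : s' ∈ (ideal σ L s).support) {x : N} {j : M} (hx : s'.assigned x = some j) :
    s.assigned x = some j ∨ ∃ e ∈ L, σ x e.1 = j := by
  induction L generalizing s with
  | nil =>
    simp only [ideal, PMF.support_pure, Set.mem_singleton_iff] at hs'
    exact Or.inl (hs' ▸ hx)
  | cons e L ih =>
    rw [ideal, PMF.mem_support_bind_iff] at hs'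
    obtain ⟨t, ht, hs'⟩ := hs'
    rcases ih hs' with h | ⟨e', he', h⟩
    · rcases mem_support_idealStep ht with ⟨-, w, hw, rfl⟩ | ⟨-, rfl⟩
      · by_cases hxw : x = w
        · subst hxw
          refine Or.inr ⟨e, List.mem_cons_self, ?_⟩
          rw [(PPState.mem_competitors.1 hw).2]
          simpa [PPState.award] using h
        · exact Or.inl (by simpa [PPState.award, hxw] using h)
      · exact Or.inl h
    · exact Or.inr ⟨e', List.mem_cons_of_mem _ he', h⟩

/-! ### Monotonicity -/

/-- Every value outside `t` is below all values of `g` on `t`, hence below their average; the extra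
points can only pull the average over `s` down. -/
theorem mean_uniformOfFinset_le_of_subset {α : Type u} [DecidableEq α] {s t : Finset α}
    (hs : s.Nonempty) (ht : t.Nonempty) (hst : t ⊆ s) {f g : α → ℝ≥0∞}
    (hfg : ∀ a ∈ t, f a ≤ g a) (hout : ∀ a ∈ s, a ∉ t → ∀ b ∈ t, f a ≤ g b) :
    mean (PMF.uniformOfFinset s hs) f ≤ mean (PMF.uniformOfFinset t ht) g := by
  set m := mean (PMF.uniformOfFinset t ht) g with hm
  have hsum : ∑ a ∈ s, f a ≤ s.card * m := by
    rw [← Finset.sum_sdiff hst]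
    have h1 : ∑ a ∈ s \ t, f a ≤ (s \ t).card * m := by
      rw [← nsmul_eq_mul]
      refine Finset.sum_le_card_nsmul _ _ _ fun a ha => ?_
      rw [Finset.mem_sdiff] at ha
      refine le_mean _ fun b hb => hout a ha.1 ha.2 b ?_
      exact (PMF.mem_support_uniformOfFinset_iff _ _).1 hb
    have h2 : ∑ a ∈ t, f a ≤ t.card * m := by
      rw [hm, card_mul_mean_uniformOfFinset]
      exact Finset.sum_le_sum hfg
    calc _ ≤ (s \ t).card * m + t.card * m := add_le_add h1 h2
      _ = s.card * m := by
        rw [← add_mul, ← Nat.cast_add, Finset.card_sdiff_add_card_eq_card hst]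
  rw [mean_uniformOfFinset]
  refine ENNReal.div_le_of_le_mul ?_
  rwa [mul_comm]

/-- Fewer survivors and more available items are better for the remaining survivors. -/
theorem mean_ideal_mono {φ : PPState N M → ℝ≥0∞}
    (hφ : ∀ s s' : PPState N M, s'.survivors ⊆ s.survivors → φ s ≤ φ s')
    (L : List (Fin (Fintype.card M) × M)) (s s' : PPState N M)
    (hS : s'.survivors ⊆ s.survivors) (hA : s.available ⊆ s'.available) :
    mean (ideal σ L s) φ ≤ mean (ideal σ L s') φ := by
  induction L generalizing s s' with
  | nil => simpa [ideal, mean_pure] using hφ s s' hS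
  | cons e L ih =>
    obtain ⟨r, j⟩ := e
    simp only [ideal, mean_bind]
    have hC : s'.competitors σ r j ⊆ s.competitors σ r j := by
      intro x hx
      rw [PPState.mem_competitors] at hx ⊢
      exact ⟨hS hx.1, hx.2⟩
    have hout : ∀ w ∈ s.competitors σ r j, w ∉ s'.competitors σ r j → w ∉ s'.survivors := by
      intro w hw hw' hs'
      rw [PPState.mem_competitors] at hw hw'
      exact hw' ⟨hs', hw.2⟩
    unfold idealStep
    split_ifs with h1 h2 h2
    -- Contested in both states: a common winner is removed from both. A winner `w` competing only
    -- in `s` is no survivor of `s'`, so removing `w` from `s` keeps the inclusion, whoever wins in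
    -- `s'`.
    · rw [mean_map, mean_map]
      refine mean_uniformOfFinset_le_of_subset _ _ hC ?_ ?_
      · intro w hw
        refine ih _ _ ?_ ?_
        · exact Finset.sdiff_subset_sdiff hS le_rfl
        · exact Finset.erase_subset_erase _ hA
      · intro w hw hw' w' _
        refine ih _ _ ?_ ?_
        · intro x hx
          simp only [PPState.award, Finset.mem_sdiff, Finset.mem_insert,
            Finset.notMem_empty, or_false] at hx ⊢
          exact ⟨hS hx.1, fun h => hout w hw hw' (h ▸ hx.1)⟩
        · exact Finset.erase_subset_erase _ hA
    -- Contested only in `s`: the item is available in `s'` too, so nobody there competes for it and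
    -- no possible winner in `s` survives in `s'`.
    · rw [mean_map, mean_pure]
      have hne : ¬ (s'.competitors σ r j).Nonempty := fun h => h2 ⟨hA h1.1, h⟩
      rw [Finset.not_nonempty_iff_eq_empty] at hne
      rw [← mean_const (PMF.uniformOfFinset _ h1.2) (mean (ideal σ L s') φ)]
      refine mean_mono _ fun w hw => ih _ _ ?_ ?_
      · have hw := (PMF.mem_support_uniformOfFinset_iff _ _).1 hw
        intro x hx
        simp only [PPState.award, Finset.mem_sdiff, Finset.mem_insert,
          Finset.notMem_empty, or_false]
        exact ⟨hS hx, fun h => hout w hw (by simp [hne]) (h ▸ hx)⟩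
      · exact (Finset.erase_subset _ _).trans hA
    -- Contested only in `s'`: the competitors in `s'` also compete in `s`, so the item must be
    -- unavailable in `s`, and erasing it from `s'` keeps the inclusion.
    · rw [mean_map, mean_pure]
      refine le_mean _ fun w' hw' => ih _ _ ?_ ?_
      · exact Finset.sdiff_subset.trans hS
      · intro k hk
        refine Finset.mem_erase.2 ⟨?_, hA hk⟩
        rintro rfl
        exact h1 ⟨hk, h2.2.mono hC⟩
    · rw [mean_pure, mean_pure]
      exact ih _ _ hS hA

/-! ### Symmetry -/

/-- Renaming the players of a state. -/
def PPState.relabel (π : Equiv.Perm N) (s : PPState N M) : PPState N M where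
  survivors := s.survivors.map π.toEmbedding
  available := s.available
  assigned := s.assigned ∘ π.symm
  current := s.current

/-- The process sees players only through their choices in the rounds of `L`, which `π` respects,
and a uniform draw is invariant under renaming. -/
theorem ideal_relabel (π : Equiv.Perm N) (L : List (Fin (Fintype.card M) × M))
    (hπ : ∀ e ∈ L, ∀ x, σ (π x) e.1 = σ x e.1) (s : PPState N M) :
    ideal σ L (s.relabel π) = (ideal σ L s).map (PPState.relabel π) := by
  induction L generalizing s with
  | nil => simp [ideal, PMF.pure_map]
  | cons e L ih =>
    have hstep : idealStep σ e (s.relabel π) = (idealStep σ e s).map (PPState.relabel π) := by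
      have hC : (s.relabel π).competitors σ e.1 e.2 =
          (s.competitors σ e.1 e.2).map π.toEmbedding := by
        ext x
        obtain ⟨y, rfl⟩ := π.surjective x
        simp [PPState.mem_competitors, PPState.relabel, hπ e List.mem_cons_self y]
      have haward : ∀ w, (s.relabel π).award (π w) e.2 ∅ = (s.award w e.2 ∅).relabel π := by
        intro w
        simp only [PPState.award, PPState.relabel, PPState.mk.injEq, and_true, true_and]
        constructor
        · ext x
          obtain ⟨y, rfl⟩ := π.surjective x
          simp
        · funext x
          obtain ⟨y, rfl⟩ := π.surjective x
          simp [Function.update_apply]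
      unfold idealStep
      by_cases h : e.2 ∈ s.available ∧ (s.competitors σ e.1 e.2).Nonempty
      · have h' : e.2 ∈ (s.relabel π).available ∧
            ((s.relabel π).competitors σ e.1 e.2).Nonempty := by
          rw [hC]; exact ⟨h.1, h.2.map⟩
        rw [dif_pos h, dif_pos h', PMF.map_comp]
        refine eq_of_mean_le fun f => le_of_eq ?_
        rw [mean_map, mean_map, mean_uniformOfFinset, mean_uniformOfFinset, hC,
          Finset.sum_map, Finset.card_map]
        simp [haward]
      · have h' : ¬ (e.2 ∈ (s.relabel π).available ∧
            ((s.relabel π).competitors σ e.1 e.2).Nonempty) := by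
          rw [hC, Finset.map_nonempty]; exact h
        rw [dif_neg h, dif_neg h', PMF.pure_map]
    simp only [ideal]
    rw [hstep, PMF.bind_map, PMF.map_bind]
    congr 1
    funext t
    exact ih (fun e he => hπ e (List.mem_cons_of_mem _ he)) t

/-- A sorted list of tournaments splits at every round. -/
theorem exists_split_rounds (L : List (Fin (Fintype.card M) × M))
    (hL : L.Pairwise fun a b => a.1 ≤ b.1) (l : Fin (Fintype.card M)) :
    ∃ L₁ L₂, L = L₁ ++ L₂ ∧ (∀ e ∈ L₁, e.1 ≤ l) ∧ ∀ e ∈ L₂, l < e.1 := by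
  induction L with
  | nil => exact ⟨[], [], by simp⟩
  | cons e L ih =>
    by_cases he : e.1 ≤ l
    · obtain ⟨L₁, L₂, rfl, h₁, h₂⟩ := ih hL.of_cons
      exact ⟨e :: L₁, L₂, rfl, by simpa [he] using h₁, h₂⟩
    · refine ⟨[], e :: L, rfl, by simp, fun e' he' => ?_⟩
      rcases List.mem_cons.1 he' with rfl | he'
      · exact not_le.1 he
      · exact (not_le.1 he).trans_le (List.rel_of_pairwise_cons hL he')

end Ideal

/-! ## Brackets -/

namespace Bracket

variable {N : Type u}

/-- Induction along the recursion of `advance` and `modulus`. -/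
theorem duel_induction {P : Bracket N → Prop} (player : ∀ i w, P (player i w))
    (pair : ∀ i w i' w', P (duel (.player i w) (.player i' w')))
    (node : ∀ l r, (∀ i w i' w', l = .player i w → r = .player i' w' → False) →
      P l → P r → P (duel l r)) : ∀ T, P T
  | .player i w => player i w
  | .duel (.player i w) (.player i' w') => pair i w i' w'
  | .duel (.player i w) (.duel l r) =>
      node _ _ (by simp) (player i w) (duel_induction player pair node (.duel l r))
  | .duel (.duel l r) T =>
      node _ _ (by simp) (duel_induction player pair node (.duel l r))
        (duel_induction player pair node T)

/-- The players still in the tournament, from left to right. -/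
def players (T : Bracket N) : List N := T.entrants.map Prod.fst

/-- The total weight of the entrants. -/
def weight (T : Bracket N) : ℕ := (T.entrants.map Prod.snd).sum

/-- The weighted sum of `u` over the entrants. -/
noncomputable def score (u : N → ℝ≥0∞) (T : Bracket N) : ℝ≥0∞ :=
  (T.entrants.map fun e => (e.2 : ℝ≥0∞) * u e.1).sum

/-- All entrants have positive weight. -/
def Positive (T : Bracket N) : Prop := ∀ e ∈ T.entrants, 0 < e.2

/-- The number of levels of duels. -/
def depth : Bracket N → ℕ
  | player _ _ => 0
  | duel l r => max l.depth r.depth + 1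

@[simp] theorem players_player (i : N) (w : ℕ) : (player i w).players = [i] := rfl

@[simp] theorem players_duel (l r : Bracket N) : (duel l r).players = l.players ++ r.players := by
  simp [players, entrants]

@[simp] theorem weight_player (i : N) (w : ℕ) : (player i w).weight = w := by
  simp [weight, entrants]

@[simp] theorem weight_duel (l r : Bracket N) : (duel l r).weight = l.weight + r.weight := by
  simp [weight, entrants]

@[simp] theorem score_player (u : N → ℝ≥0∞) (i : N) (w : ℕ) : (player i w).score u = w * u i := by
  simp [score, entrants]

@[simp] theorem score_duel (u : N → ℝ≥0∞) (l r : Bracket N) :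
    (duel l r).score u = l.score u + r.score u := by
  simp [score, entrants]

@[simp] theorem positive_player (i : N) (w : ℕ) : (player i w).Positive ↔ 0 < w := by
  simp [Positive, entrants]

@[simp] theorem positive_duel (l r : Bracket N) :
    (duel l r).Positive ↔ l.Positive ∧ r.Positive := by
  simp only [Positive, entrants, List.mem_append]
  exact ⟨fun h => ⟨fun e he => h e (Or.inl he), fun e he => h e (Or.inr he)⟩,
    fun h e he => he.elim (h.1 e) (h.2 e)⟩

/-- Each duel joins two nonempty subtrees. This is why the levels reserved in the timetable suffice
for every tree. -/
theorem depth_lt_length_players (T : Bracket N) : T.depth < T.players.length := by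
  induction T with
  | player i w => simp [depth]
  | duel l r hl hr => simp only [depth, players_duel, List.length_append]; omega

theorem champion_mem_players (T : Bracket N) : T.champion ∈ T.players := by
  induction T with
  | player i w => simp [champion]
  | duel l r hl _ => simp [champion, hl]

/-! ### One level of duels -/

theorem duelWinner_eq_or (i : N) (w : ℕ) (i' : N) (w' : ℕ) (s s' : Option ℕ) :
    duelWinner i w i' w' s s' = i ∨ duelWinner i w i' w' s s' = i' := by
  unfold duelWinner
  split
  · split_ifs <;> simp
  all_goals simp

theorem advance_duel (o : ℕ → N → Option ℕ) {l r : Bracket N}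
    (h : ∀ i w i' w', l = .player i w → r = .player i' w' → False) :
    (duel l r).advance o = duel (l.advance o) (r.advance o) := by
  rw [advance]
  exact fun i w i' w' hl hr => h i w i' w' hl hr

theorem players_advance (o : ℕ → N → Option ℕ) (T : Bracket N) :
    (T.advance o).players.Sublist T.players := by
  induction T using duel_induction with
  | player i w => simp [advance]
  | pair i w i' w' =>
    simp only [advance, players_player, players_duel, List.cons_append, List.nil_append]
    rcases duelWinner_eq_or i w i' w' (o (w + w') i) (o (w + w') i') with h | h <;> simp [h]
  | node l r h hl hr =>
    rw [advance_duel o h, players_duel, players_duel]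
    exact hl.append hr

theorem weight_advance (o : ℕ → N → Option ℕ) (T : Bracket N) :
    (T.advance o).weight = T.weight := by
  induction T using duel_induction with
  | player i w => simp [advance]
  | pair i w i' w' => simp [advance]
  | node l r h hl hr => simp [advance_duel o h, hl, hr]

theorem Positive.advance (o : ℕ → N → Option ℕ) {T : Bracket N} (hT : T.Positive) :
    (T.advance o).Positive := by
  induction T using duel_induction with
  | player i w => simpa [Bracket.advance] using hT
  | pair i w i' w' =>
    simp only [positive_duel, positive_player] at hT
    simp only [Bracket.advance, positive_player]
    omega
  | node l r h hl hr =>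
    rw [positive_duel] at hT
    rw [advance_duel o h, positive_duel]
    exact ⟨hl hT.1, hr hT.2⟩

/-- A duel that cannot be fought yet has another duel below it, so the maximum of the depths really
drops. Truncated subtraction covers a finished bracket, which merely waits for the end of the
timetable. -/
theorem depth_advance (o : ℕ → N → Option ℕ) (T : Bracket N) :
    (T.advance o).depth = T.depth - 1 := by
  induction T using duel_induction with
  | player i w => simp [advance, depth]
  | pair i w i' w' => simp [advance, depth]
  | node l r h hl hr =>
    rw [advance_duel o h, depth, depth, hl, hr]
    have : 0 < max l.depth r.depth := by
      cases l with
      | duel l l' => simp [depth]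
      | player i w =>
        cases r with
        | duel l l' => simp [depth]
        | player i' w' => exact absurd rfl fun hr => h i w i' w' rfl hr
    omega

variable [DecidableEq N]

theorem modulus_duel (x : N) {l r : Bracket N}
    (h : ∀ i w i' w', l = .player i w → r = .player i' w' → False) :
    (duel l r).modulus x = (l.modulus x).orElse fun _ => r.modulus x := by
  rw [modulus]
  exact fun i w i' w' hl hr => h i w i' w' hl hr

theorem modulus_duel_cases {x : N} {k : ℕ} {l r : Bracket N}
    (h : ∀ i w i' w', l = .player i w → r = .player i' w' → False)
    (hx : (duel l r).modulus x = some k) : l.modulus x = some k ∨ r.modulus x = some k := by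
  rw [modulus_duel x h] at hx
  cases hl : l.modulus x with
  | none => rw [hl] at hx; exact Or.inr hx
  | some k' => rw [hl] at hx; exact Or.inl hx

theorem mem_players_of_modulus {T : Bracket N} {x : N} {k : ℕ} (h : T.modulus x = some k) :
    x ∈ T.players := by
  induction T using duel_induction with
  | player i w => simp [modulus] at h
  | pair i w i' w' =>
    simp only [modulus] at h
    split_ifs at h with hx
    simpa using hx
  | node l r hlr hl hr =>
    rw [players_duel, List.mem_append]
    rcases modulus_duel_cases hlr h with h | h
    · exact Or.inl (hl h)
    · exact Or.inr (hr h)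

theorem modulus_duel_left {x : N} {k : ℕ} {l r : Bracket N}
    (h : ∀ i w i' w', l = .player i w → r = .player i' w' → False)
    (hx : l.modulus x = some k) : (duel l r).modulus x = some k := by
  rw [modulus_duel x h, hx]; rfl

/-- The search for a duel looks at the left subtree first; distinctness of the players ensures that
it finds nothing there. -/
theorem modulus_duel_right {x : N} {k : ℕ} {l r : Bracket N}
    (h : ∀ i w i' w', l = .player i w → r = .player i' w' → False)
    (hd : (duel l r).players.Nodup) (hx : r.modulus x = some k) :
    (duel l r).modulus x = some k := by
  have hl : l.modulus x = none := by
    by_contra hl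
    obtain ⟨k', hk'⟩ := Option.ne_none_iff_exists'.1 hl
    rw [players_duel] at hd
    exact (List.disjoint_of_nodup_append hd) (mem_players_of_modulus hk')
      (mem_players_of_modulus hx)
  rw [modulus_duel x h, hl]; exact hx

theorem modulus_pos {T : Bracket N} (hT : T.Positive) {x : N} {k : ℕ}
    (h : T.modulus x = some k) : 0 < k := by
  induction T using duel_induction with
  | player i w => simp [modulus] at h
  | pair i w i' w' =>
    simp only [positive_duel, positive_player] at hT
    simp only [modulus] at h
    split_ifs at h
    simp only [Option.some.injEq] at h
    omega
  | node l r hlr hl hr =>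
    rw [positive_duel] at hT
    rcases modulus_duel_cases hlr h with h | h
    · exact hl hT.1 h
    · exact hr hT.2 h

/-- If some duellists fail to open and are added to `X`, then the score with respect to a function
that grows with the set of expelled players does not decrease. -/
theorem score_advance_mono {u v : N → ℝ≥0∞} {X : Finset N} {o o' : ℕ → N → Option ℕ}
    (huv : ∀ a a', a ∈ insert a' X → u a ≤ v a') {T : Bracket N} (hd : T.players.Nodup)
    (ho : ∀ x k, T.modulus x = some k →
      (∃ s, o k x = some s) ∧ (o' k x = o k x ∨ o' k x = none ∧ x ∈ X)) :
    (T.advance o).score u ≤ (T.advance o').score v := by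
  induction T using duel_induction with
  | player i w =>
    simp only [advance, score_player]
    gcongr
    exact huv i i (Finset.mem_insert_self _ _)
  | pair i w i' w' =>
    simp only [advance, score_player]
    gcongr
    -- In each pattern of failures the winner under `o` either still wins under `o'` or failed to
    -- open and lies in `X`. When both fail, the left player wins by default and the right one is in
    -- `X`.
    refine huv _ _ (Finset.mem_insert.2 ?_)
    obtain ⟨⟨s, hs⟩, h⟩ := ho i (w + w') (by simp [modulus])
    obtain ⟨⟨s', hs'⟩, h'⟩ := ho i' (w + w') (by simp [modulus])
    rw [hs] at h
    rw [hs'] at h'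
    rw [hs, hs']
    rcases h with h | ⟨h, hX⟩ <;> rcases h' with h' | ⟨h', hX'⟩ <;> rw [h, h'] <;>
      simp only [duelWinner] <;> split_ifs <;> simp [*]
  | node l r h hl hr =>
    rw [advance_duel o h, advance_duel o' h, score_duel, score_duel]
    have hd' := hd
    rw [players_duel] at hd'
    exact add_le_add
      (hl hd'.of_append_left fun x k hx => ho x k (modulus_duel_left h hx))
      (hr hd'.of_append_right fun x k hx => ho x k (modulus_duel_right h hd hx))

/-- The values that the players commit to. -/
def committed (a : N → Action ℕ) (_ : ℕ) (x : N) : Option ℕ :=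
  match a x with
  | .commit s => some s
  | _ => none

/-- If all duellists commit to independent uniform residues and open them, then the expected score
is preserved. -/
theorem mean_score_advance [Fintype N] (u : N → ℝ≥0∞) (p : N → PMF (Action ℕ)) {T : Bracket N}
    (hd : T.players.Nodup) (hT : T.Positive)
    (hp : ∀ x k, T.modulus x = some k → p x = (uniformBelow k).map Action.commit) :
    mean (independent p) (fun a => (T.advance (committed a)).score u) = T.score u := by
  induction T using duel_induction with
  | player i w => simp [advance, mean_const]
  | pair i w i' w' =>
    have hne : i ≠ i' := by simpa using hd
    simp only [positive_duel, positive_player] at hT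
    have hk : 0 < w + w' := by omega
    have hi := hp i (w + w') (by simp [modulus])
    have hi' := hp i' (w + w') (by simp [modulus])
    -- With all other shares held fixed, the share of `i'` alone makes the duel fair.
    rw [mean_independent_update p i']
    rw [← mean_const (independent p) (score u _)]
    refine mean_congr _ fun f hf => ?_
    have hfi := mem_support_independent hf i
    rw [hi, PMF.support_map] at hfi
    obtain ⟨s, -, hs⟩ := hfi
    rw [hi', mean_map]
    simp only [advance, score_player, score_duel]
    rw [← mul_mean_uniformBelow_duel w w' s hk, ← mean_const_mul]
    congr 1
    funext s'
    simp only [Function.comp, committed, Function.update_self, Function.update_of_ne hne, ← hs,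
      duelWinner]
    split_ifs <;> rfl
  | node l r h hl hr =>
    have hd' := hd
    rw [players_duel] at hd'
    rw [positive_duel] at hT
    simp only [advance_duel _ h, score_duel, mean_add]
    rw [hl hd'.of_append_left hT.1 fun x k hx => hp x k (modulus_duel_left h hx),
      hr hd'.of_append_right hT.2 fun x k hx => hp x k (modulus_duel_right h hd hx)]

end Bracket

/-! ## Executions of the Preference Priority protocol -/

namespace Choices

variable {N : Type u} {M : Type v} [Fintype N] [DecidableEq N] [Fintype M] [DecidableEq M]

/-! ### The state along a transcript -/

/-- The bookkeeping that holds along every transcript. -/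
structure Sound (s : PPState N M) : Prop where
  assigned : ∀ x j, s.assigned x = some j → x ∉ s.survivors ∧ j ∉ s.available
  injective : ∀ x y j, s.assigned x = some j → s.assigned y = some j → x = y
  item : ∀ t, s.current = some t → t.item ∈ s.available
  group : ∀ t, s.current = some t → t.group ⊆ s.survivors
  players : ∀ t, s.current = some t → ∀ x ∈ t.bracket.players, x ∈ t.group
  corrupted : ∀ t, s.current = some t → t.corrupted ⊆ t.group

theorem Sound.award {s : PPState N M} (h : Sound s) {w : N} {j : M} (hw : w ∈ s.survivors)
    (hj : j ∈ s.available) (X : Finset N) : Sound (s.award w j X) where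
  assigned x k hx := by
    simp only [PPState.award] at hx ⊢
    by_cases hxw : x = w
    · subst hxw
      simp only [Function.update_self, Option.some.injEq] at hx
      simp [hx]
    · have := h.assigned x k (by simpa [hxw] using hx)
      simp [this]
  injective x y k hx hy := by
    simp only [PPState.award] at hx hy
    by_cases hxw : x = w <;> by_cases hyw : y = w
    · rw [hxw, hyw]
    · subst hxw
      simp only [Function.update_self, Option.some.injEq] at hx
      subst hx
      exact absurd hj (h.assigned y _ (by simpa [hyw] using hy)).2
    · subst hyw
      simp only [Function.update_self, Option.some.injEq] at hy
      subst hy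
      exact absurd hj (h.assigned x _ (by simpa [hxw] using hx)).2
    · exact h.injective x y k (by simpa [hxw] using hx) (by simpa [hyw] using hy)
  item t ht := by simp [PPState.award] at ht
  group t ht := by simp [PPState.award] at ht
  players t ht := by simp [PPState.award] at ht
  corrupted t ht := by simp [PPState.award] at ht

/-- The champion and the corrupted players lie in the group, so the double complement in the
protocol removes exactly these players. -/
theorem nextState_finish (c : Choices N M) (σ : Profile N M) (b : N → Option (Broadcast ℕ))
    {s : PPState N M} {t : Tournament N M} (ht : s.current = some t)
    (hp : ∀ x ∈ t.bracket.players, x ∈ t.group) (hX : t.corrupted ⊆ t.group) :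
    c.nextState σ b s .finish = s.award t.bracket.champion t.item t.corrupted := by
  have hsub : insert t.bracket.champion t.corrupted ⊆ t.group :=
    Finset.insert_subset (hp _ t.bracket.champion_mem_players) hX
  simp only [nextState, ht, PPState.award]
  rw [Finset.sdiff_sdiff_eq_self hsub]

theorem mem_players_bracket (c : Choices N M) {C : Finset N} {hC : C.Nonempty} {x : N}
    (hx : x ∈ (c.bracket C hC).players) : x ∈ C := by
  obtain ⟨e, he, rfl⟩ := List.mem_map.1 hx
  have he' : e ∈ ((c.bracket C hC).entrants : Multiset (N × ℕ)) := he
  rw [c.bracket_entrants, Multiset.mem_map] at he'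
  obtain ⟨y, hy, rfl⟩ := he'
  exact hy

theorem Sound.nextState (c : Choices N M) (σ : Profile N M) (b : N → Option (Broadcast ℕ))
    {s : PPState N M} (h : Sound s) (task : Task M) : Sound (c.nextState σ b s task) := by
  cases task with
  | start r j =>
    simp only [Choices.nextState]
    split_ifs with hc
    · refine ⟨h.assigned, h.injective, ?_, ?_, ?_, ?_⟩ <;> rintro t ht <;>
        obtain rfl := Option.some.inj ht
      · exact hc.1
      · exact Finset.filter_subset _ _
      · exact fun x hx => c.mem_players_bracket hx
      · exact Finset.empty_subset _
    · exact ⟨h.assigned, h.injective, by simp, by simp, by simp, by simp⟩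
  | commit => exact h
  | reveal =>
    simp only [Choices.nextState]
    cases hcur : s.current with
    | none => exact h
    | some t =>
      refine ⟨h.assigned, h.injective, ?_, ?_, ?_, ?_⟩ <;> rintro t' ht <;>
        obtain rfl := Option.some.inj ht
      · exact h.item t hcur
      · exact h.group t hcur
      · exact fun x hx => h.players t hcur x ((Bracket.players_advance _ _).subset hx)
      · exact Finset.union_subset (h.corrupted t hcur) (Finset.filter_subset _ _)
  | finish =>
    cases hcur : s.current with
    | none => simpa only [Choices.nextState, hcur] using h
    | some t =>
      rw [c.nextState_finish σ b hcur (h.players t hcur) (h.corrupted t hcur)]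
      exact h.award (h.group t hcur (h.players t hcur _ t.bracket.champion_mem_players))
        (h.item t hcur) _

theorem sound_state (c : Choices N M) (σ : Profile N M) (h : Transcript N ℕ) :
    Sound (c.state σ h) := by
  induction h with
  | nil => constructor <;> simp [state]
  | cons b h ih =>
    simp only [state]
    cases c.schedule[h.length]? with
    | none => exact ih
    | some task => exact ih.nextState c σ b task

/-- Items go to champions, who are survivors, while owners of items are not; so the update never
overwrites an entry. -/
theorem assigned_cons (c : Choices N M) (σ : Profile N M) (b : N → Option (Broadcast ℕ))
    (h : Transcript N ℕ) {x : N} {j : M} (hx : (c.state σ h).assigned x = some j) :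
    (c.state σ (b :: h)).assigned x = some j := by
  have hS := c.sound_state σ h
  simp only [state]
  cases c.schedule[h.length]? with
  | none => exact hx
  | some task =>
    cases task with
    | start r k => simp only [nextState]; split_ifs <;> exact hx
    | commit => exact hx
    | reveal =>
      simp only [nextState]
      cases (c.state σ h).current <;> exact hx
    | finish =>
      cases hcur : (c.state σ h).current with
      | none => simpa only [nextState, hcur] using hx
      | some t =>
        simp only [nextState, hcur]
        have hne : x ≠ t.bracket.champion := by
          rintro rfl
          exact (hS.assigned _ _ hx).1
            (hS.group t hcur (hS.players t hcur _ t.bracket.champion_mem_players))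
        rw [Function.update_of_ne hne]
        exact hx

/-! ### Runs -/

variable {K : Finset N} (c : Choices N M)
  (adv : Profile N M → AdvView N ℕ K → PMF (Finset {i // i ∈ K})) (σ : Profile N M)

/-- One round of the protocol against a fail-stop adversary. -/
noncomputable def step (d : Config N ℕ) : PMF (Config N ℕ) :=
  (independent fun x => match c.schedule[d.transcript.length]? with
    | some task => action (c.state σ d.transcript) x task
    | none => PMF.pure Action.idle).bind fun a =>
    (adv σ
      { transcript := d.transcript
        corruptLogs := fun i => d.logs i
        corruptActions := fun i => a i
        honestMessages := fun i => publish (d.logs i) (a i) }).map fun B =>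
      d.next a (B.map (Function.Embedding.subtype fun i => i ∈ K))

/-- `m` rounds of the protocol against a fail-stop adversary. -/
noncomputable def run : ℕ → Config N ℕ → PMF (Config N ℕ)
  | 0, d => PMF.pure d
  | m + 1, d => (c.step adv σ d).bind (run m)

/-- `step` and `run` are the general definitions with the value type unfolded to `ℕ`. -/
theorem preferencePriority_run (m : ℕ) (d : Config N ℕ) :
    c.preferencePriority.run adv σ m d = c.run adv σ m d := by
  induction m generalizing d with
  | zero => rfl
  | succ m ih => exact congrArg (PMF.bind (c.step adv σ d)) (funext ih)

theorem mean_run_zero (d : Config N ℕ) (F : Config N ℕ → ℝ≥0∞) :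
    mean (c.run adv σ 0 d) F = F d :=
  mean_pure d F

theorem run_add (m m' : ℕ) (d : Config N ℕ) :
    c.run adv σ (m + m') d = (c.run adv σ m d).bind (c.run adv σ m') := by
  induction m generalizing d with
  | zero => rw [Nat.zero_add]; exact (PMF.pure_bind d (c.run adv σ m')).symm
  | succ m ih =>
    rw [Nat.succ_add, run, run, PMF.bind_bind]
    congr 1
    funext d'
    exact ih d'

variable {c σ}

/-! ### One communication round under attack -/

theorem getElem?_of_drop {α : Type w} {l l' : List α} {n : ℕ} {a : α}
    (h : l.drop n = a :: l') : l[n]? = some a := by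
  have := congrArg (fun l => l[0]?) h
  simpa using this

theorem drop_succ_of_drop {α : Type w} {l l' : List α} {n : ℕ} {a : α}
    (h : l.drop n = a :: l') : l.drop (n + 1) = l' := by
  rw [← List.drop_drop, h]; rfl

/-- One round, given a lower bound for every possible choice of actions. -/
theorem mean_le_mean_run_succ {d : Config N ℕ} {task : Task M} {rest : List (Task M)}
    (hd : c.schedule.drop d.transcript.length = task :: rest) {m : ℕ} {F : Config N ℕ → ℝ≥0∞}
    {G : (N → Action ℕ) → ℝ≥0∞}
    (h : ∀ a : N → Action ℕ, (∀ x, a x ∈ (action (c.state σ d.transcript) x task).support) →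
      ∀ B ⊆ K, G a ≤ mean (c.run adv σ m (d.next a B)) F) :
    mean (independent fun x => action (c.state σ d.transcript) x task) G ≤
      mean (c.run adv σ (m + 1) d) F := by
  rw [run, step, getElem?_of_drop hd, PMF.bind_bind, mean_bind]
  refine mean_mono _ fun a ha => ?_
  rw [PMF.bind_map, mean_bind]
  -- The lottery of the adversary may depend on the drawn actions; a bound valid for every `B` makes
  -- its view irrelevant.
  refine le_mean _ fun B _ => ?_
  refine h a (fun x => mem_support_independent ha x) _ fun x hx => ?_
  obtain ⟨y, -, rfl⟩ := Finset.mem_map.1 hx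
  exact y.2

theorem le_mean_run_succ {d : Config N ℕ} {task : Task M} {rest : List (Task M)}
    (hd : c.schedule.drop d.transcript.length = task :: rest) {m : ℕ} {F : Config N ℕ → ℝ≥0∞}
    {v : ℝ≥0∞}
    (h : ∀ a : N → Action ℕ, (∀ x, a x ∈ (action (c.state σ d.transcript) x task).support) →
      ∀ B ⊆ K, v ≤ mean (c.run adv σ m (d.next a B)) F) :
    v ≤ mean (c.run adv σ (m + 1) d) F := by
  have := mean_le_mean_run_succ adv hd (G := fun _ => v) h
  rwa [mean_const] at this

theorem drop_next {d : Config N ℕ} {task : Task M} {rest : List (Task M)}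
    (hd : c.schedule.drop d.transcript.length = task :: rest) (a : N → Action ℕ) (B : Finset N) :
    c.schedule.drop (d.next a B).transcript.length = rest :=
  drop_succ_of_drop hd

theorem state_next {d : Config N ℕ} {task : Task M} {rest : List (Task M)}
    (hd : c.schedule.drop d.transcript.length = task :: rest) (a : N → Action ℕ) (B : Finset N) :
    ∃ b, c.state σ (d.next a B).transcript = c.nextState σ b (c.state σ d.transcript) task ∧
      ∀ x, b x = some (publish (d.logs x) (a x)) ∨
        b x = none ∧ (Stopped d.transcript x ∨ x ∈ B) := by
  classical
  refine ⟨fun i => if Stopped d.transcript i ∨ i ∈ B then none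
    else some (publish (d.logs i) (a i)), ?_, fun x => ?_⟩
  · simp only [Config.next, state]
    rw [getElem?_of_drop hd]
    congr!
  · by_cases hx : Stopped d.transcript x ∨ x ∈ B <;> simp [hx]

theorem not_stopped_next {d : Config N ℕ} (hd : ∀ x ∉ K, ¬ Stopped d.transcript x)
    (a : N → Action ℕ) {B : Finset N} (hB : B ⊆ K) :
    ∀ x ∉ K, ¬ Stopped (d.next a B).transcript x := by
  rintro x hx ⟨b, hb, hbx⟩
  rcases List.mem_cons.1 hb with rfl | hb
  · have := hd x hx
    simp only [this, false_or, ite_eq_left_iff, reduceCtorEq, imp_false, not_not] at hbx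
    exact hx (hB hbx)
  · exact hd x hx ⟨b, hb, hbx⟩

end Choices

namespace Choices

variable {N : Type u} {M : Type v} [Fintype N] [DecidableEq N] [Fintype M] [DecidableEq M]
  {K : Finset N} {c : Choices N M}
  (adv : Profile N M → AdvView N ℕ K → PMF (Finset {i // i ∈ K})) {σ : Profile N M}

/-! ### A single tournament -/

/-- In the round after its commitment a duellist opens the committed residue, unless it is
corrupted and stops. -/
theorem opening_eq {b : N → Option (Broadcast ℕ)} {log : List (Action ℕ)} {x : N} {k z : ℕ}
    (hz : z < k) (hb : b x = some (publish (Action.commit z :: log) (Action.reveal 0))) :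
    opening b k x = some z := by
  simp [opening, hb, publish, commitments, hz]

/-- Lower bound for a tournament. The value `h a X` of the outcome in which `a` wins and the players
in `X` are expelled is compared with its average over the entrants. -/
theorem score_le_mean_run {s : PPState N M} {j : M} {C : Finset N} {rest : List (Task M)}
    {h : N → Finset N → ℝ≥0∞} {F : Config N ℕ → ℝ≥0∞}
    (hmono : ∀ a a' X X', X ⊆ X' → X' ⊆ K → a ∈ insert a' X' → h a X ≤ h a' X')
    (hF : ∀ d' w X, c.schedule.drop d'.transcript.length = rest →
      (∀ x ∉ K, ¬ Stopped d'.transcript x) → X ⊆ K → w ∈ C →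
      c.state σ d'.transcript = s.award w j X → h w X ≤ F d')
    (m : ℕ) (d : Config N ℕ) (T : Bracket N) (X : Finset N)
    (hd : c.schedule.drop d.transcript.length =
      (List.replicate m [Task.commit, Task.reveal]).flatten ++ Task.finish :: rest)
    (hst : ∀ x ∉ K, ¬ Stopped d.transcript x)
    (hs : c.state σ d.transcript = { s with current := some ⟨j, C, T, X⟩ })
    (hT : ∀ x ∈ T.players, x ∈ C) (hnd : T.players.Nodup) (hpos : T.Positive)
    (hXC : X ⊆ C) (hXK : X ⊆ K) (hdepth : T.depth ≤ m) :
    T.score (fun a => h a X) ≤ mean (c.run adv σ (2 * m + 1) d) fun d' => T.weight * F d' := by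
  induction m generalizing d T X with
  | zero =>
    cases T with
    | duel l r => simp [Bracket.depth] at hdepth
    | player a w =>
      have hd : c.schedule.drop d.transcript.length = Task.finish :: rest := by simpa using hd
      refine le_mean_run_succ adv hd fun a' _ B hB => ?_
      rw [mean_run_zero, Bracket.score_player, Bracket.weight_player]
      gcongr
      obtain ⟨b, hb, -⟩ := state_next (σ := σ) hd a' B
      refine hF _ _ _ (drop_next hd _ _) (not_stopped_next hst _ hB) hXK (hT a (by simp)) ?_
      rw [hb, hs, c.nextState_finish σ b (t := ⟨j, C, .player a w, X⟩) rfl hT hXC]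
      rfl
  | succ m ih =>
    have hd : c.schedule.drop d.transcript.length = Task.commit :: Task.reveal ::
        ((List.replicate m [Task.commit, Task.reveal]).flatten ++ Task.finish :: rest) := by
      simpa [List.replicate_succ] using hd
    have hcom : ∀ x k, T.modulus x = some k →
        action (c.state σ d.transcript) x .commit = (uniformBelow k).map Action.commit := by
      intro x k hx
      simp [action, hs, hx]
    -- The potential is rewritten as its mean after honest duels with the shares about to be
    -- committed. What remains is a comparison for each fixed draw.
    rw [← Bracket.mean_score_advance (fun a => h a X)
      (fun x => action (c.state σ d.transcript) x .commit) hnd hpos hcom]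
    refine mean_le_mean_run_succ adv hd fun a ha B hB => ?_
    have hd₁ := drop_next hd a B
    have hst₁ := not_stopped_next hst a hB
    have hs₁ : c.state σ (d.next a B).transcript = { s with current := some ⟨j, C, T, X⟩ } := by
      obtain ⟨b, hb, -⟩ := state_next (σ := σ) hd a B
      rw [hb, hs]; rfl
    refine le_mean_run_succ adv hd₁ fun a' ha' B' hB' => ?_
    obtain ⟨b, hb, hbx⟩ := state_next (σ := σ) hd₁ a' B'
    have hopen : ∀ x k, T.modulus x = some k → (∃ z, Bracket.committed a k x = some z) ∧
        (opening b k x = Bracket.committed a k x ∨ opening b k x = none ∧ x ∈ K) := by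
      intro x k hx
      have h1 := ha x
      rw [hcom x k hx, PMF.support_map] at h1
      obtain ⟨z, hz, hzx⟩ := h1
      have hzk := lt_of_mem_support_uniformBelow (Bracket.modulus_pos hpos hx) hz
      have h2 : a' x = Action.reveal 0 := by
        have := ha' x
        rw [hs₁] at this
        simpa [action, hx] using this
      have hcomm : Bracket.committed a k x = some z := by
        simp [Bracket.committed, ← hzx]
      refine ⟨⟨z, hcomm⟩, ?_⟩
      rcases hbx x with h3 | ⟨h3, h4⟩
      · left
        rw [hcomm]
        refine opening_eq (log := d.logs x) hzk ?_
        rw [h3, h2, hzx]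
        rfl
      -- Silence in the opening round comes from stopping now or earlier, including in the
      -- commitment round, and both are confined to `K`.
      · refine Or.inr ⟨by simp [opening, h3], ?_⟩
        by_contra hxK
        exact h4.elim (hst₁ x hxK) fun h => hxK (hB' h)
    set X' := X ∪ C.filter fun i => ∃ k ∈ T.modulus i, opening b k i = none with hX'
    have hXX' : X ⊆ X' := Finset.subset_union_left
    have hX'K : X' ⊆ K := by
      refine Finset.union_subset hXK fun x hx => ?_
      obtain ⟨k, hk, hko⟩ := (Finset.mem_filter.1 hx).2
      obtain ⟨⟨z, hz⟩, h1 | h1⟩ := hopen x k hk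
      · rw [hko, hz] at h1; simp at h1
      · exact h1.2
    have hscore : (T.advance (Bracket.committed a)).score (fun y => h y X) ≤
        (T.advance (opening b)).score (fun y => h y X') := by
      refine Bracket.score_advance_mono (X := X')
        (fun y y' hy => hmono y y' X X' hXX' hX'K hy) hnd fun x k hx => ?_
      obtain ⟨h1, h2⟩ := hopen x k hx
      refine ⟨h1, h2.imp_right fun h3 => ⟨h3.1, Finset.mem_union_right _ ?_⟩⟩
      exact Finset.mem_filter.2 ⟨hT x (Bracket.mem_players_of_modulus hx), k, hx, h3.1⟩
    refine hscore.trans ?_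
    rw [← T.weight_advance (opening b)]
    have hsub := T.players_advance (opening b)
    refine ih _ _ _ (drop_next hd₁ _ _) (not_stopped_next hst₁ _ hB') ?_
      (fun x hx => hT x (hsub.subset hx)) (hnd.sublist hsub) (hpos.advance _)
      (Finset.union_subset hXC (Finset.filter_subset _ _)) hX'K ?_
    · rw [hb, hs₁]; rfl
    · rw [Bracket.depth_advance]; omega

/-- Rounds without a tournament do not change the state. -/
theorem le_mean_run_of_current_eq_none {s : PPState N M} (hcur : s.current = none)
    {rest : List (Task M)} {v : ℝ≥0∞} {F : Config N ℕ → ℝ≥0∞}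
    (hF : ∀ d', c.schedule.drop d'.transcript.length = rest →
      (∀ x ∉ K, ¬ Stopped d'.transcript x) → c.state σ d'.transcript = s → v ≤ F d')
    (ts : List (Task M)) (hts : ∀ r j, Task.start r j ∉ ts) (d : Config N ℕ)
    (hd : c.schedule.drop d.transcript.length = ts ++ rest)
    (hst : ∀ x ∉ K, ¬ Stopped d.transcript x) (hs : c.state σ d.transcript = s) :
    v ≤ mean (c.run adv σ ts.length d) F := by
  induction ts generalizing d with
  | nil =>
    rw [List.length_nil, mean_run_zero]
    exact hF d hd hst hs
  | cons task ts ih =>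
    refine le_mean_run_succ adv hd fun a _ B hB => ?_
    obtain ⟨b, hb, -⟩ := state_next (σ := σ) hd a B
    refine ih (fun r j h => hts r j (List.mem_cons_of_mem _ h)) _ (drop_next hd _ _)
      (not_stopped_next hst _ hB) ?_
    rw [hb, hs]
    cases task with
    | start r j => exact absurd List.mem_cons_self (hts r j)
    | commit => rfl
    | reveal => simp [nextState, hcur]
    | finish => simp [nextState, hcur]

/-! ### The bracket of a tournament -/

variable (c) in
theorem coe_players_bracket (C : Finset N) (hC : C.Nonempty) :
    ((c.bracket C hC).players : Multiset N) = C.val := by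
  have := congrArg (Multiset.map Prod.fst) (c.bracket_entrants C hC)
  simpa [Bracket.players, Multiset.map_map] using this

variable (c) in
theorem positive_bracket (C : Finset N) (hC : C.Nonempty) : (c.bracket C hC).Positive := by
  intro e he
  have he' : e ∈ ((c.bracket C hC).entrants : Multiset (N × ℕ)) := he
  rw [c.bracket_entrants, Multiset.mem_map] at he'
  obtain ⟨y, -, rfl⟩ := he'
  exact Nat.one_pos

variable (c) in
theorem weight_bracket (C : Finset N) (hC : C.Nonempty) : (c.bracket C hC).weight = C.card := by
  have := congrArg (fun m => (Multiset.map Prod.snd m).sum) (c.bracket_entrants C hC)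
  simpa [Bracket.weight, Multiset.map_map] using this

variable (c) in
theorem score_bracket (u : N → ℝ≥0∞) (C : Finset N) (hC : C.Nonempty) :
    (c.bracket C hC).score u = ∑ a ∈ C, u a := by
  have := congrArg (fun m => (Multiset.map (fun e : N × ℕ => (e.2 : ℝ≥0∞) * u e.1) m).sum)
    (c.bracket_entrants C hC)
  simpa [Bracket.score, Multiset.map_map] using this

variable (c) in
theorem depth_bracket (C : Finset N) (hC : C.Nonempty) :
    (c.bracket C hC).depth ≤ Fintype.card N := by
  have h1 := (c.bracket C hC).depth_lt_length_players
  have h2 := congrArg Multiset.card (c.coe_players_bracket C hC)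
  have h3 : C.card ≤ Fintype.card N := C.card_le_univ
  simp only [Multiset.coe_card, Finset.card_val] at h2
  omega

/-! ### The whole timetable -/

/-- The tasks of the tournament for the item `e.2` in round `e.1`. -/
def block (e : Fin (Fintype.card M) × M) : List (Task M) :=
  Task.start e.1 e.2 ::
    (List.replicate (Fintype.card M) [Task.commit, Task.reveal]).flatten ++ [Task.finish]

/-- The tournaments in the order of the timetable. -/
def agenda (c : Choices N M) : List (Fin (Fintype.card M) × M) :=
  (List.finRange (Fintype.card M)).flatMap fun r =>
    (List.finRange (Fintype.card M)).map fun k => (r, c.order r k)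

variable (c) in
theorem schedule_eq : c.schedule = c.agenda.flatMap block := by
  simp only [schedule, agenda, List.flatMap_assoc, List.flatMap_map]
  rfl

variable (c) in
theorem mem_agenda (e : Fin (Fintype.card M) × M) : e ∈ c.agenda := by
  simp only [agenda, List.mem_flatMap, List.mem_map, List.mem_finRange, true_and]
  exact ⟨e.1, (c.order e.1).symm e.2, by simp⟩

variable (c) in
theorem pairwise_agenda : c.agenda.Pairwise fun a b => a.1 ≤ b.1 := by
  rw [agenda, List.pairwise_flatMap]
  constructor
  · intro r _
    rw [List.pairwise_map]
    exact List.pairwise_of_forall fun _ _ => le_rfl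
  · refine (List.pairwise_lt_finRange _).imp fun {r r'} hr e he e' he' => ?_
    obtain ⟨_, _, rfl⟩ := List.mem_map.1 he
    obtain ⟨_, _, rfl⟩ := List.mem_map.1 he'
    exact hr.le

/-- The players outside `K` have left the competition only with an item of a round in `R`. -/
def Served (σ : Profile N M) (K : Finset N) (R : Fin (Fintype.card M) → Prop)
    (s : PPState N M) : Prop :=
  ∀ x ∉ K, x ∉ s.survivors → ∃ r, R r ∧ s.assigned x = some (σ x r)

/-- The ideal process is a lower bound for the execution. -/
theorem mean_ideal_le_mean_run (hcard : Fintype.card N = Fintype.card M)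
    {φ : PPState N M → ℝ≥0∞}
    (hφ : ∀ (L : List (Fin (Fintype.card M) × M)) (s : PPState N M) (j : M) (a a' : N)
      (X X' : Finset N), X ⊆ X' → X' ⊆ K → a ∈ insert a' X' →
      mean (ideal σ L (s.award a j X)) φ ≤ mean (ideal σ L (s.award a' j X')) φ)
    {rest : List (Task M)} {F : Config N ℕ → ℝ≥0∞} (R : Fin (Fintype.card M) → Prop)
    (hF : ∀ d', c.schedule.drop d'.transcript.length = rest →
      (∀ x ∉ K, ¬ Stopped d'.transcript x) → Served σ K R (c.state σ d'.transcript) →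
      φ (c.state σ d'.transcript) ≤ F d')
    (L : List (Fin (Fintype.card M) × M)) (hL : ∀ e ∈ L, R e.1) (d : Config N ℕ)
    (hd : c.schedule.drop d.transcript.length = L.flatMap block ++ rest)
    (hst : ∀ x ∉ K, ¬ Stopped d.transcript x) (hcur : (c.state σ d.transcript).current = none)
    (hserved : Served σ K R (c.state σ d.transcript)) :
    mean (ideal σ L (c.state σ d.transcript)) φ ≤
      mean (c.run adv σ (L.flatMap block).length d) F := by
  induction L generalizing d with
  | nil =>
    rw [List.flatMap_nil, List.length_nil, mean_run_zero, ideal, mean_pure]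
    exact hF d hd hst hserved
  | cons e L ih =>
    obtain ⟨r, j⟩ := e
    have hR : R r := hL (r, j) List.mem_cons_self
    have hL' : ∀ e ∈ L, R e.1 := fun e he => hL e (List.mem_cons_of_mem _ he)
    set s := c.state σ d.transcript with hs
    -- The start, two rounds for each level of duels, and the final award.
    have hlen : (block (r, j)).length = (2 * Fintype.card M + 1) + 1 := by
      simp [block]; ring
    rw [List.flatMap_cons, List.length_append, hlen, run_add, mean_bind, ideal, mean_bind]
    have hd₀ : c.schedule.drop d.transcript.length = Task.start r j ::
        ((List.replicate (Fintype.card M) [Task.commit, Task.reveal]).flatten ++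
          Task.finish :: (L.flatMap block ++ rest)) := by
      simpa [block] using hd
    have hsound := c.sound_state σ d.transcript
    refine le_mean_run_succ adv hd₀ fun a _ B hB => ?_
    obtain ⟨b, hb, -⟩ := state_next (σ := σ) hd₀ a B
    have hst₁ := not_stopped_next hst a hB
    have hd₁ := drop_next hd₀ a B
    rw [← hs] at hb hsound
    unfold idealStep
    split_ifs with hcond
    · have hC := hcond.2
      simp only at hC
      set C := s.competitors σ r j with hCdef
      have hb' : c.state σ (d.next a B).transcript =
          { s with current := some ⟨j, C, c.bracket C hC, ∅⟩ } := by
        rw [hb]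
        simp only [nextState]
        exact dif_pos hcond
      -- The value of an outcome is the mean of `φ` when the ideal process continues from it; the
      -- induction hypothesis bounds the real continuation from below.
      have key := score_le_mean_run adv (s := s) (j := j) (C := C)
        (h := fun w X => mean (ideal σ L (s.award w j X)) φ)
        (F := fun d' => mean (c.run adv σ (L.flatMap block).length d') F)
        (fun a a' X X' => hφ L s j a a' X X')
        (fun d' w X hd' hst' hXK hw hs' => by
          rw [← hs']
          refine ih hL' d' hd' hst' ?_ ?_
          · rw [hs']; rfl
          · rw [hs']
            intro x hxK hx
            obtain ⟨hwS, hwj⟩ := PPState.mem_competitors.1 hw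
            by_cases hxw : x = w
            · subst hxw
              exact ⟨r, hR, by simp [PPState.award, hwj]⟩
            · have hxS : x ∉ s.survivors := by
                intro hxS
                refine hx ?_
                simp only [PPState.award, Finset.mem_sdiff, Finset.mem_insert, hxw, false_or]
                -- Only members of `K` are expelled, so an honest player other than the winner
                -- stays.
                exact ⟨hxS, fun h => hxK (hXK h)⟩
              obtain ⟨r', hr', h'⟩ := hserved x hxK hxS
              exact ⟨r', hr', by simpa [PPState.award, hxw] using h'⟩)
        (Fintype.card M) (d.next a B) (c.bracket C hC) ∅ hd₁ hst₁ hb'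
        (fun x hx => c.mem_players_bracket hx)
        (by rw [← Multiset.coe_nodup, c.coe_players_bracket]; exact C.nodup)
        (c.positive_bracket C hC) (Finset.empty_subset _) (Finset.empty_subset _)
        (hcard ▸ c.depth_bracket C hC)
      rw [mean_const_mul, c.weight_bracket, c.score_bracket] at key
      rw [mean_map, mean_uniformOfFinset]
      refine ENNReal.div_le_of_le_mul ?_
      rw [mul_comm]
      exact key
    · have hb' : c.state σ (d.next a B).transcript = s := by
        rw [hb]
        simp only [nextState]
        refine (dif_neg hcond).trans ?_
        rw [← hcur]
      rw [mean_pure]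
      have hlen' : 2 * Fintype.card M + 1 =
          ((List.replicate (Fintype.card M) [Task.commit, Task.reveal]).flatten ++
            [(Task.finish : Task M)]).length := by
        simp; ring
      rw [hlen']
      refine le_mean_run_of_current_eq_none adv hcur (rest := L.flatMap block ++ rest) ?_ _ ?_ _
        (by simpa using hd₁) hst₁ hb'
      · intro d' hd' hst' hs'
        rw [← hs']
        refine ih hL' d' hd' hst' ?_ ?_ <;> rw [hs']
        · exact hcur
        · exact hserved
      · intro r' j' h
        simp [List.mem_flatten, List.mem_replicate] at h

end Choices

variable {N : Type u} {M : Type v} [Fintype N] [DecidableEq N] [Fintype M] [DecidableEq M]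

/-! ## Ranks and expected matrices -/

theorem sum_matrixOf (σ : Profile N M) (A : N ≃ M) (i : N) (l : Fin (Fintype.card M)) :
    ∑ k ∈ Finset.Iic l, matrixOf A i (σ i k) = if (σ i).symm (A i) ≤ l then 1 else 0 := by
  have : ∀ k, matrixOf A i (σ i k) = if (σ i).symm (A i) = k then 1 else 0 := by
    intro k
    simp [matrixOf, Equiv.symm_apply_eq]
  simp only [this, Finset.sum_ite_eq, Finset.mem_Iic]

/-- Dominance is tested on the prefix that ends at the item assigned by `A`. -/
theorem rank_le_of_matrixDominates {σ : Profile N M} {A A' : N ≃ M}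
    (h : MatrixDominates σ (matrixOf A') (matrixOf A)) (i : N) :
    (σ i).symm (A' i) ≤ (σ i).symm (A i) := by
  have := h i ((σ i).symm (A i))
  rw [sum_matrixOf, sum_matrixOf, if_pos le_rfl] at this
  by_contra hlt
  rw [if_neg hlt] at this
  linarith

theorem toReal_mean_assignment (ρ : PMF (N ≃ M)) (f : (N ≃ M) → ℝ≥0∞) (hf : ∀ A, f A ≠ ∞) :
    (mean ρ f).toReal = ∑ A, (ρ A).toReal * (f A).toReal := by
  rw [mean, tsum_fintype, ENNReal.toReal_sum]
  · simp [ENNReal.toReal_mul]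
  · exact fun A _ => ENNReal.mul_ne_top (ρ.apply_ne_top A) (hf A)

theorem expMatrix_eq (ρ : PMF (N ≃ M)) (i : N) (j : M) :
    expMatrix ρ i j = (mean ρ fun A => if A i = j then 1 else 0).toReal := by
  rw [toReal_mean_assignment _ _ (by intro A; split_ifs <;> simp), expMatrix]
  refine Finset.sum_congr rfl fun A _ => ?_
  unfold matrixOf
  split_ifs <;> simp

theorem sum_expMatrix_eq (σ : Profile N M) (ρ : PMF (N ≃ M)) (i : N)
    (l : Fin (Fintype.card M)) :
    ∑ k ∈ Finset.Iic l, expMatrix ρ i (σ i k) =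
      (mean ρ fun A => if (σ i).symm (A i) ≤ l then 1 else 0).toReal := by
  rw [toReal_mean_assignment _ _ (by intro A; split_ifs <;> simp)]
  simp only [expMatrix]
  rw [Finset.sum_comm]
  refine Finset.sum_congr rfl fun A _ => ?_
  rw [← Finset.mul_sum, sum_matrixOf]
  split_ifs <;> simp

/-! ## Existence of the choices -/

theorem exists_bracket (C : Finset N) (hC : C.Nonempty) :
    ∃ T : Bracket N, (T.entrants : Multiset (N × ℕ)) = C.val.map fun i => (i, 1) := by
  -- A caterpillar tree: each entrant meets the winner of all the entrants to its right.
  have key : ∀ (l : List N) (a : N), ∃ T : Bracket N,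
      T.entrants = (a :: l).map fun i => (i, 1) := by
    intro l
    induction l with
    | nil => exact fun a => ⟨.player a 1, rfl⟩
    | cons b l ih =>
      intro a
      obtain ⟨T, hT⟩ := ih b
      exact ⟨.duel (.player a 1) T, by simp [Bracket.entrants, hT]⟩
  obtain ⟨a, l, hl⟩ := List.exists_cons_of_ne_nil (Finset.Nonempty.toList_ne_nil hC)
  obtain ⟨T, hT⟩ := key l a
  refine ⟨T, ?_⟩
  rw [hT, ← hl, ← Multiset.map_coe, Finset.coe_toList]

theorem exists_completion (hcard : Fintype.card N = Fintype.card M) (A : N → Option M) :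
    ∃ g : N ≃ M, (∀ i i' j, A i = some j → A i' = some j → i = i') →
      ∀ i j, A i = some j → g i = j := by
  let e : N ≃ M := Fintype.equivOfCardEq hcard
  by_cases hA : ∀ i i' j, A i = some j → A i' = some j → i = i'
  · obtain ⟨g, hg⟩ := Finset.exists_equiv_extend_of_card_eq
      (t := (Finset.univ : Finset M)) (by rw [hcard]; rfl)
      (s := Finset.univ.filter fun i => A i ≠ none) (f := fun i => (A i).getD (e i))
      (Finset.subset_univ _) (by
        intro i hi i' hi' h
        simp only [ne_eq, Finset.coe_filter, Finset.mem_univ, true_and, Set.mem_ofPred_eq] at hi hi'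
        obtain ⟨j, hj⟩ := Option.ne_none_iff_exists'.1 hi
        obtain ⟨j', hj'⟩ := Option.ne_none_iff_exists'.1 hi'
        simp only [hj, hj', Option.getD_some] at h
        exact hA i i' j hj (h ▸ hj'))
    refine ⟨g.trans (Equiv.subtypeUnivEquiv fun j => Finset.mem_univ j), fun _ i j hij => ?_⟩
    have := hg i (by simp [hij])
    simpa [hij] using this
  · exact ⟨e, fun h => absurd h hA⟩

theorem nonempty_choices (hcard : Fintype.card N = Fintype.card M) : Nonempty (Choices N M) := by
  choose T hT using exists_bracket (N := N)
  choose g hg using exists_completion (N := N) (M := M) hcard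
  exact ⟨⟨fun _ => (Fintype.equivFin M).symm, T, hT, g, hg⟩⟩

/-! ## The mechanism realized by the protocol and its security -/

namespace Choices

variable (c : Choices N M) (σ : Profile N M)

/-- The initial state. -/
def initial : PPState N M := ⟨Finset.univ, Finset.univ, fun _ => none, none⟩

theorem consistent_initial : Consistent (initial : PPState N M) where
  mem_survivors := by simp [initial]
  mem_available := by simp [initial]
  injective := by simp [initial]

theorem pending_initial : Pending σ c.agenda initial := fun _ _ _ _ => c.mem_agenda _

/-- The law of the final configuration. -/
noncomputable def finalLaw {K : Finset N}
    (adv : Profile N M → AdvView N ℕ K → PMF (Finset {i // i ∈ K})) : PMF (Config N ℕ) :=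
  c.run adv σ c.schedule.length ⟨fun _ => [], []⟩

theorem exec_eq {K : Finset N}
    (adv : Profile N M → AdvView N ℕ K → PMF (Finset {i // i ∈ K})) :
    c.preferencePriority.exec adv σ =
      (c.finalLaw σ adv).map fun d => c.complete (c.state σ d.transcript).assigned := by
  rw [finalLaw, ← preferencePriority_run]
  rfl

theorem not_stopped_initial (K : Finset N) :
    ∀ x ∉ K, ¬ Stopped (⟨fun _ => [], []⟩ : Config N ℕ).transcript x := by
  rintro x - ⟨b, hb, -⟩
  exact absurd hb List.not_mem_nil

theorem served_initial (K : Finset N) (R : Fin (Fintype.card M) → Prop) :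
    Served σ K R (c.state σ []) := fun x _ hx => by simp [state] at hx

/-- Without corruption the protocol follows the ideal process. -/
theorem map_state_finalLaw (hcard : Fintype.card N = Fintype.card M)
    (adv : Profile N M → AdvView N ℕ ∅ → PMF (Finset {i : N // i ∈ (∅ : Finset N)})) :
    (c.finalLaw σ adv).map (fun d => c.state σ d.transcript) = ideal σ c.agenda initial := by
  -- With no corrupted player both expelled sets are empty and the winners coincide, so the
  -- monotonicity condition holds for every `φ`.
  refine (eq_of_mean_le fun φ => ?_).symm
  rw [mean_map, finalLaw, c.schedule_eq]
  refine mean_ideal_le_mean_run adv hcard (φ := φ) ?_ (rest := []) (fun _ => True)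
    (fun _ _ _ _ => le_rfl) c.agenda (fun _ _ => trivial) ⟨fun _ => [], []⟩ ?_
    (not_stopped_initial ∅) rfl (c.served_initial σ ∅ _)
  · intro L s j a a' X X' hX hX' ha
    obtain rfl := Finset.subset_empty.1 hX'
    obtain rfl := Finset.subset_empty.1 hX
    obtain rfl : a = a' := by simpa using ha
    exact le_rfl
  · rw [c.schedule_eq]; simp

theorem honestExec_eq (hcard : Fintype.card N = Fintype.card M) :
    c.preferencePriority.honestExec σ =
      (ideal σ c.agenda initial).map fun s => c.complete s.assigned := by
  rw [← c.map_state_finalLaw σ hcard fun _ _ => PMF.pure ∅, PMF.map_comp]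
  exact c.exec_eq σ fun _ _ => PMF.pure ∅

/-- The ideal process assigns everything, so that the completion rule changes nothing. -/
theorem assigned_of_mem_support (hcard : Fintype.card N = Fintype.card M) {s : PPState N M}
    (hs : s ∈ (ideal σ c.agenda initial).support) (x : N) :
    s.assigned x = some (c.complete s.assigned x) := by
  obtain ⟨hc, hp⟩ := ideal_consistent_pending consistent_initial (c.pending_initial σ) hs
  obtain ⟨j, hj⟩ := Option.ne_none_iff_exists'.1 (assigned_ne_none hcard hc hp x)
  rw [c.complete_extends s.assigned hc.injective x j hj, hj]

theorem stable_honestExec (hcard : Fintype.card N = Fintype.card M) :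
    Mechanism.Stable (c.preferencePriority.honestExec) := by
  rintro σ A hA ⟨A', hne, hdom⟩
  rw [c.honestExec_eq σ hcard, PMF.support_map] at hA
  obtain ⟨s, hs, rfl⟩ := hA
  have has := c.assigned_of_mem_support σ hcard hs
  refine hne (Equiv.ext fun x => ?_)
  -- A dominating assignment gives nobody a worse item, so it must coincide with the outcome of the
  -- process.
  refine ideal_agree A' c.pairwise_agenda consistent_initial (c.pending_initial σ) (fun _ => rfl)
    hs (fun y j hy => ?_) x _ (has x)
  rw [has y] at hy
  rw [← Option.some.inj hy]
  exact rank_le_of_matrixDominates hdom y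

theorem mean_honestExec (hcard : Fintype.card N = Fintype.card M) (f : (N ≃ M) → ℝ≥0∞) :
    mean (c.preferencePriority.honestExec σ) f =
      mean (ideal σ c.agenda initial) fun s => f (c.complete s.assigned) := by
  rw [c.honestExec_eq σ hcard, mean_map]; rfl

/-- Who gets an item of rank at most `l` is settled by the rounds up to `l`. In these rounds `i` and
`i'` make the same choices, so exchanging them is a symmetry of the truncated process and of the
initial state. -/
theorem equalTreatment_honestExec (hcard : Fintype.card N = Fintype.card M) :
    Mechanism.StrongEqualTreatment (c.preferencePriority.honestExec) := by
  intro σ i i' l hl k hk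
  obtain ⟨L₁, L₂, hL, h₁, h₂⟩ := exists_split_rounds c.agenda c.pairwise_agenda l
  have key : ∀ x, mean (c.preferencePriority.honestExec σ)
      (fun A => if A x = σ x k then 1 else 0) =
      mean (ideal σ L₁ initial) fun s => if s.assigned x = some (σ x k) then 1 else 0 := by
    intro x
    rw [c.mean_honestExec σ hcard]
    rw [mean_congr (g := fun s => if s.assigned x = some (σ x k) then 1 else 0) _ fun s hs => by
      rw [c.assigned_of_mem_support σ hcard hs x]; simp]
    rw [hL, ideal_append, mean_bind]
    refine mean_congr _ fun s hs => ?_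
    have hc := ideal_consistent consistent_initial hs
    rw [← mean_const (ideal σ L₂ s) (ite _ _ _)]
    refine mean_congr _ fun s' hs' => ?_
    have hiff : s'.assigned x = some (σ x k) ↔ s.assigned x = some (σ x k) := by
      refine ⟨fun h => ?_, ideal_assigned_mono hc hs'⟩
      rcases ideal_assigned_cases hs' h with h | ⟨e, he, h⟩
      · exact h
      · exact absurd ((h₂ e he).trans_eq ((σ x).injective h)) (not_lt.2 hk)
    simp only [hiff]
  rw [expMatrix_eq, expMatrix_eq, key, key]
  congr 1
  have hπ := ideal_relabel (σ := σ) (Equiv.swap i i') L₁ (fun e he x => by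
    have he := hl e.1 (h₁ e he)
    by_cases hx : x = i
    · rw [hx, Equiv.swap_apply_left, he]
    · by_cases hx' : x = i'
      · rw [hx', Equiv.swap_apply_right, he]
      · rw [Equiv.swap_apply_of_ne_of_ne hx hx']) initial
  have hinit : (initial : PPState N M).relabel (Equiv.swap i i') = initial := by
    simp only [initial, PPState.relabel, PPState.mk.injEq, and_true, true_and]
    exact ⟨by ext; simp, rfl⟩
  rw [hinit] at hπ
  conv_rhs => rw [hπ, mean_map]
  refine mean_congr _ fun s _ => ?_
  simp [PPState.relabel, hl k hk]

/-! ### Maximin security -/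

theorem assigned_of_mem_support_run {K : Finset N}
    (adv : Profile N M → AdvView N ℕ K → PMF (Finset {i // i ∈ K})) {m : ℕ} {d d' : Config N ℕ}
    (h : d' ∈ (c.run adv σ m d).support) {x : N} {j : M}
    (hx : (c.state σ d.transcript).assigned x = some j) :
    (c.state σ d'.transcript).assigned x = some j := by
  induction m generalizing d with
  | zero =>
    rw [run, PMF.support_pure, Set.mem_singleton_iff] at h
    rwa [h]
  | succ m ih =>
    rw [run, PMF.mem_support_bind_iff] at h
    obtain ⟨d₁, h₁, h⟩ := h
    refine ih h ?_
    rw [step, PMF.mem_support_bind_iff] at h₁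
    obtain ⟨a, -, h₁⟩ := h₁
    rw [PMF.support_map] at h₁
    obtain ⟨B, -, rfl⟩ := h₁
    exact c.assigned_cons σ _ _ hx

theorem maximinSecure (hcard : Fintype.card N = Fintype.card M) (K : Finset N)
    (adv : Profile N M → AdvView N ℕ K → PMF (Finset {i // i ∈ K})) :
    c.preferencePriority.MaximinSecure adv := by
  intro σ i hi l
  obtain ⟨L₁, L₂, hL, h₁, h₂⟩ := exists_split_rounds c.agenda c.pairwise_agenda l
  rw [sum_expMatrix_eq, sum_expMatrix_eq]
  refine ENNReal.toReal_mono (mean_ne_top _ fun A => by split_ifs <;> simp) ?_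
  -- Being out of the competition, rather than owning an item, depends on the survivors alone and is
  -- therefore monotone; for an honest player the execution makes the two equivalent.
  let φ : PPState N M → ℝ≥0∞ := fun s => if i ∈ s.survivors then 0 else 1
  have hφ : ∀ s s' : PPState N M, s'.survivors ⊆ s.survivors → φ s ≤ φ s' := by
    intro s s' h
    by_cases hs : i ∈ s.survivors
    · simp [φ, hs]
    · have hs' : i ∉ s'.survivors := fun h' => hs (h h')
      simp [φ, hs, hs']
  -- If `i` survives the rounds up to `l`, its final item comes from a later round and has rank
  -- greater than `l`.
  have hhonest : mean (c.preferencePriority.honestExec σ)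
      (fun A => if (σ i).symm (A i) ≤ l then 1 else 0) ≤ mean (ideal σ L₁ initial) φ := by
    rw [c.mean_honestExec σ hcard]
    have hmem := fun s (hs : s ∈ (ideal σ c.agenda initial).support) =>
      c.assigned_of_mem_support σ hcard hs i
    rw [hL, ideal_append] at hmem
    rw [hL, ideal_append, mean_bind]
    refine mean_mono _ fun s hs => ?_
    have hc := ideal_consistent consistent_initial hs
    rw [← mean_const (ideal σ L₂ s) (φ s)]
    refine mean_mono _ fun s' hs' => ?_
    by_cases his : i ∈ s.survivors
    · rw [if_neg]
      · exact zero_le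
      · have ha := hmem s' ((PMF.mem_support_bind_iff _ _ _).2 ⟨s, hs, hs'⟩)
        rcases ideal_assigned_cases hs' ha with h | ⟨e, he, h⟩
        · rw [(hc.mem_survivors i).1 his] at h
          exact absurd h.symm (Option.some_ne_none _)
        · rw [← h, Equiv.symm_apply_apply]
          exact not_le.2 (h₂ e he)
    · have : φ s = 1 := by simp [φ, his]
      rw [this]
      split_ifs <;> simp
  refine hhonest.trans ?_
  have hsched : c.schedule = L₁.flatMap block ++ L₂.flatMap block := by
    rw [c.schedule_eq, hL, List.flatMap_append]
  rw [c.exec_eq σ adv, mean_map, finalLaw, hsched, List.length_append, run_add, mean_bind]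
  refine mean_ideal_le_mean_run adv hcard (φ := φ) ?_ (rest := L₂.flatMap block) (fun r => r ≤ l)
    ?_ L₁ h₁ ⟨fun _ => [], []⟩ (by rw [hsched]; rfl) (not_stopped_initial K) rfl
    (c.served_initial σ K _)
  · intro L s j a a' X X' hX hX' ha
    refine mean_ideal_mono hφ L _ _ (Finset.sdiff_subset_sdiff le_rfl ?_) le_rfl
    exact Finset.insert_subset ha (hX.trans (Finset.subset_insert _ _))
  · intro d _ _ hserved
    by_cases his : i ∈ (c.state σ d.transcript).survivors
    · simp [φ, his]
    -- An honest player that has left owns an item of rank at most `l`, and neither the remaining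
    -- rounds nor the completion rule can take it away.
    · obtain ⟨r, hr, hri⟩ := hserved i hi his
      refine le_mean _ fun d' hd' => ?_
      have hfin := c.assigned_of_mem_support_run σ adv hd' hri
      have hcomp := c.complete_extends _ (c.sound_state σ d'.transcript).injective i _ hfin
      simp [φ, his, hcomp, hr]

end Choices

end Assignment

theorem theorem2 {N M : Type*} [Fintype N] [DecidableEq N] [Fintype M] [DecidableEq M]
    (hcard : Fintype.card N = Fintype.card M) :
    Nonempty (Assignment.Choices N M) ∧
      ∀ c : Assignment.Choices N M,
        ∃ F : Assignment.Mechanism N M,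
          F.Stable ∧ F.StrongEqualTreatment ∧ c.preferencePriority.Realizes F ∧
            ∀ K : Finset N, K.card ≤ Fintype.card N - 1 →
              ∀ adv : Assignment.FailStopAdversary c.preferencePriority K,
                c.preferencePriority.MaximinSecure adv :=
  ⟨Assignment.nonempty_choices hcard, fun c =>
    ⟨c.preferencePriority.honestExec, c.stable_honestExec hcard,
      c.equalTreatment_honestExec hcard, fun _ => rfl,
      fun K _ adv => c.maximinSecure hcard K adv⟩⟩
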